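/- All graphs are finite, simple and undirected. The graph polynomial of $G$ is $P(G)=\prod_{uv\in E(G)}(u-v)\in\mathbb{Z}[V(G)]$, where the vertices serve as variables and every edge is oriented arbitrarily (the orientation only affects the sign). A monomial is non-vanishing if its coefficient in $P(G)$ is non-zero. Two vertices of $G$ are in the same colour class if every proper $3$-colouring of $G$ gives them the same colour, and in different colour classes otherwise. An outerplane graph is a near-triangulation if all its inner faces are triangles. For two vertices $a,b$ of a block $B$ of an outerplane graph, the fundamental $a$–$b$ subgraph of $B$ is the edge $ab$ if $a$ and $b$ are adjacent, and otherwise the subgraph of $B$ induced by the vertices of the faces on the shortest path, in the weak dual of $B$, between the faces containing $a$ and the faces containing $b$. Let $G$ be a connected outerplane graph with at least one cutvertex and let $x,y$ be vertices lying in two different blocks. The fundamental $x$–$y$ subgraph of $G$ is the union of the blocks on the shortest path, in the block-cutvertex graph of $G$, between the blocks containing $x$ and the blocks containing $y$, each restricted to its fundamental $a$–$b$ subgraph, where $a,b$ are the two cutvertices of this path that belong to the block (with $x$, respectively $y$, in place of the missing cutvertex in the first, respectively last, block). $G$ is $xy$-fundamental if it equals its fundamental $x$–$y$ subgraph. Theorem.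 Let $G$ be a connected outerplanar near-triangulation with at least one cutvertex which is $xy$-fundamental, and let $CV(G)=(x,v_1,\dots,v_{j-1},y)$ be the sequence of $x$, the cutvertices of $G$, and $y$, in the order in which they occur on any path from $x$ to $y$. Then: 1. if all vertices of $CV(G)$ are in the same colour class, $P(G)$ has a non-vanishing monomial in which $x$ and $y$ have exponent $1$ and every other vertex has exponent at most $2$; 2. if exactly one pair of successive vertices of $CV(G)$ is in different colour classes, $P(G)$ has a non-vanishing monomial in which $x$ has exponent $0$, $y$ has exponent $1$, and every other vertex has exponent at most $2$; 3. if at least two pairs of successive vertices of $CV(G)$ are in different colour classes, $P(G)$ has a non-vanishing monomial in which $x$ and $y$ have exponent $0$ and every other vertex has exponent at most $2$. -/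

import Mathlib

/-! Graphs are simple and undirected on a vertex type `V`.  A subgraph that is induced by a set of
vertices (a block, for instance) is represented by that set. -/

namespace Outerplanar

variable {V : Type*}

/-! ### Shortest paths between two sets of vertices -/

/-- `p` is a shortest walk among all the walks from a vertex of `S` to a vertex of `T`. -/
def IsShortestBetween {W : Type*} (H : SimpleGraph W) (S T : Set W) {s t : W}
    (p : H.Walk s t) : Prop :=
  s ∈ S ∧ t ∈ T ∧ ∀ s' ∈ S, ∀ t' ∈ T, ∀ q : H.Walk s' t', p.length ≤ q.length

/-! ### Cutvertices, blocks and the block-cutvertex graph -/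

/-- `v` is a cutvertex of `G`: its deletion separates two other vertices of one component. -/
def IsCutvertex (G : SimpleGraph V) (v : V) : Prop :=
  ∃ a b : V, a ≠ v ∧ b ≠ v ∧ G.Reachable a b ∧ ∀ p : G.Walk a b, v ∈ p.support

/-- `B` is the vertex set of a block of `G`: a maximal connected subgraph that has no cutvertex
of its own. -/
def IsBlock (G : SimpleGraph V) (B : Set V) : Prop :=
  Maximal (fun S : Set V => (G.induce S).Connected ∧ ∀ v, ¬ IsCutvertex (G.induce S) v) B

/-- The block-cutvertex graph of `G`: a cutvertex is joined to the blocks that contain it. -/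
def blockCutGraph (G : SimpleGraph V) :
    SimpleGraph ({B : Set V // IsBlock G B} ⊕ {v : V // IsCutvertex G v}) where
  Adj s t :=
    (∃ B v, s = Sum.inl B ∧ t = Sum.inr v ∧ v.1 ∈ B.1) ∨
    (∃ B v, s = Sum.inr v ∧ t = Sum.inl B ∧ v.1 ∈ B.1)
  symm := ⟨by
    rintro s t (⟨B, v, hs, ht, h⟩ | ⟨B, v, hs, ht, h⟩)
    · exact Or.inr ⟨B, v, ht, hs, h⟩
    · exact Or.inl ⟨B, v, ht, hs, h⟩⟩
  loopless := ⟨by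
    rintro s (⟨B, v, hs, ht, -⟩ | ⟨B, v, hs, ht, -⟩)
    · exact Sum.inl_ne_inr (hs.symm.trans ht)
    · exact Sum.inl_ne_inr (ht.symm.trans hs)⟩

/-! ### Outerplane graphs, their inner faces and the weak dual -/

/-- An outerplane drawing of `G`: the vertices are placed on a circle, in the cyclic order given by
`pos`, the edges are drawn as straight chords, and no two chords cross. -/
structure OuterplaneDrawing (G : SimpleGraph V) where
  /-- the place of a vertex when one walks once around the circle -/
  pos : V → ℕ
  pos_injective : Function.Injective pos
  noncrossing : ∀ a b c d : V, G.Adj a c → G.Adj b d →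
    ¬ (pos a < pos b ∧ pos b < pos c ∧ pos c < pos d)

/-- `w` lies strictly between `u` and `v` in the linear order that is given by `pos`. -/
def Between (pos : V → ℕ) (u w v : V) : Prop :=
  (pos u < pos w ∧ pos w < pos v) ∨ (pos v < pos w ∧ pos w < pos u)

/-- `u` and `v` are neighbours on the convex polygon with vertex set `F`: one of the two open arcs
of the circle between `u` and `v` contains no vertex of `F`. -/
def ConsecutiveIn (pos : V → ℕ) (F : Finset V) (u v : V) : Prop :=
  (∀ w ∈ F, ¬ Between pos u w v) ∨ (∀ w ∈ F, w ≠ u → w ≠ v → Between pos u w v)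

/-- `F` is the vertex set of an inner (that is, bounded) face of the part of the drawing `D` that is
induced by `B`: a convex polygon all of whose sides, and none of whose diagonals, are edges.  No
other edge can meet its interior, as edges do not cross. -/
def IsInnerFace {G : SimpleGraph V} (D : OuterplaneDrawing G) (B : Set V) (F : Finset V) : Prop :=
  (F : Set V) ⊆ B ∧ 3 ≤ F.card ∧
    ∀ u ∈ F, ∀ v ∈ F, u ≠ v → (G.Adj u v ↔ ConsecutiveIn D.pos F u v)

/-- Every inner face is a triangle. -/
def IsNearTriangulation {G : SimpleGraph V} (D : OuterplaneDrawing G) : Prop :=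
  ∀ F : Finset V, IsInnerFace D Set.univ F → F.card = 3

/-- The weak dual of the outerplane graph induced by `B`: its vertices are the inner faces, and two
faces are adjacent when they share an edge. -/
def weakDual {G : SimpleGraph V} (D : OuterplaneDrawing G) (B : Set V) :
    SimpleGraph {F : Finset V // IsInnerFace D B F} where
  Adj F F' := F ≠ F' ∧
    ∃ u v : V, G.Adj u v ∧ (u ∈ F.1 ∧ v ∈ F.1) ∧ (u ∈ F'.1 ∧ v ∈ F'.1)
  symm := ⟨by
    rintro F F' ⟨hne, u, v, huv, h, h'⟩
    exact ⟨hne.symm, u, v, huv, h', h⟩⟩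
  loopless := ⟨fun _ h => h.1 rfl⟩

/-! ### Fundamental subgraphs -/

/-- The vertex set of the fundamental `a`-`b` subgraph of the 2-connected outerplane graph induced
by `B`: the vertices of the faces on the shortest path of the weak dual between the faces that
contain `a` and the faces that contain `b`; if `ab` is an edge, just `a` and `b`. -/
def fundamentalVerts {G : SimpleGraph V} (D : OuterplaneDrawing G) (B : Set V) (a b : V) : Set V :=
  {v | (G.Adj a b ∧ (v = a ∨ v = b)) ∨
    (¬ G.Adj a b ∧ ∃ (s t : {F : Finset V // IsInnerFace D B F}) (p : (weakDual D B).Walk s t),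
      IsShortestBetween (weakDual D B) {F | a ∈ F.1} {F | b ∈ F.1} p ∧
      ∃ F ∈ p.support, v ∈ F.1)}

/-- The block `B` lies on the shortest path of the block-cutvertex graph between the blocks that
contain `x` and the blocks that contain `y`, and `a`, `b` are the two ends of its passage: each of
them is a cutvertex on this path (or `x` or `y`, for the extreme blocks) that belongs to `B`. -/
def IsPassage (G : SimpleGraph V) (x y : V) (B : Set V) (a b : V) : Prop :=
  ∃ (hB : IsBlock G B) (s t : {B : Set V // IsBlock G B} ⊕ {v : V // IsCutvertex G v})
    (p : (blockCutGraph G).Walk s t),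
    IsShortestBetween (blockCutGraph G)
      {n | ∃ C, n = Sum.inl C ∧ x ∈ C.1} {n | ∃ C, n = Sum.inl C ∧ y ∈ C.1} p ∧
    Sum.inl ⟨B, hB⟩ ∈ p.support ∧ a ≠ b ∧
    (a ∈ B ∧ (a = x ∨ a = y ∨ ∃ c, Sum.inr c ∈ p.support ∧ c.1 = a)) ∧
    (b ∈ B ∧ (b = x ∨ b = y ∨ ∃ c, Sum.inr c ∈ p.support ∧ c.1 = b))

/-- The fundamental `x`-`y` subgraph: the union of the blocks on the shortest path of the
block-cutvertex graph, each one restricted to the fundamental subgraph between the two ends of its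
passage. -/
def fundamentalSubgraph {G : SimpleGraph V} (D : OuterplaneDrawing G) (x y : V) : G.Subgraph :=
  ⨆ (B : Set V) (a : V) (b : V) (_ : IsPassage G x y B a b),
    (⊤ : G.Subgraph).induce (fundamentalVerts D B a b)

/-- `G` is `xy`-fundamental: it is equal to its fundamental `x`-`y` subgraph. -/
def IsFundamental {G : SimpleGraph V} (D : OuterplaneDrawing G) (x y : V) : Prop :=
  fundamentalSubgraph D x y = ⊤

/-! ### The sequence of cutvertices and the colour classes -/

open Classical in
/-- `x`, the cutvertices and `y`, in the order in which they occur on the path `p` from `x`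
to `y`. -/
noncomputable def cutvertexSequence {G : SimpleGraph V} {x y : V} (p : G.Walk x y) : List V :=
  p.support.filter (fun v => v = x ∨ v = y ∨ IsCutvertex G v)

/-- `u` and `v` belong to the same colour class: every proper 3-colouring of `G` gives them the same
colour. -/
def SameColourClass (G : SimpleGraph V) (u v : V) : Prop :=
  ∀ C : G.Coloring (Fin 3), C u = C v

open Classical in
/-- The number of pairs of successive entries of `l` that lie in different colour classes. -/
noncomputable def numChanges (G : SimpleGraph V) (l : List V) : ℕ :=
  (l.zip l.tail).countP (fun e => ¬ SameColourClass G e.1 e.2)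

/-! ### The graph polynomial -/

/-- `r` orients every edge of `G` in exactly one of the two directions. -/
def IsOrientation (G : SimpleGraph V) (r : V → V → Prop) : Prop :=
  ∀ u v : V, G.Adj u v → Xor (r u v) (r v u)

open Classical in
/-- The graph polynomial: the product of `u - v` over all edges `uv`, oriented by `r`. -/
noncomputable def graphPolynomial [Fintype V] (G : SimpleGraph V) (r : V → V → Prop) :
    MvPolynomial V ℤ :=
  ∏ e : V × V with G.Adj e.1 e.2 ∧ r e.1 e.2, (MvPolynomial.X e.1 - MvPolynomial.X e.2)

/-- The graph polynomial has a non-vanishing monomial in which `x` has exponent `i`, `y` has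
exponent `j`, and every other vertex has exponent at most 2. -/
def HasMonomial [Fintype V] (G : SimpleGraph V) (r : V → V → Prop) (x y : V) (i j : ℕ) : Prop :=
  ∃ m : V →₀ ℕ, (graphPolynomial G r).coeff m ≠ 0 ∧ m x = i ∧ m y = j ∧
    ∀ v, v ≠ x → v ≠ y → m v ≤ 2

end Outerplanar

namespace Outerplanar

open MvPolynomial Finsupp

/-! ### The polynomial of an induced subgraph -/

section Algebra

variable {V : Type*}

/-! `G` is a row of links glued at the vertices of the sequence: each block contributes either a
single edge or a chain of triangles between its two ends. Successive links share one vertex and no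
edge runs between different links away from it, so the graph polynomial is, up to sign, the product
of the polynomials of the links. These are homogeneous, so a monomial of such a product arises in
only one way, and its coefficient is the product of the two coefficients (`HasMonomialOn.glue`). It
remains to find good monomials for one link and to balance the exponents at the shared vertices.

Along a chain of triangles starting at `a`, one follows the coefficients at the monomials of degree
three in `a` and the two ends of the current edge `uv`, every vertex left behind having exponent
`2`. Attaching a triangle acts on them, up to a factor, by a linear map of order three, in step with
the 3-colouring forced by the triangles; thus the zero pattern of the coefficients tells which of
`u`, `v` has the colour of `a`, if either does (`StripCase.attach`). A link then has monomials with
exponents `(0, 1)` and `(1, 0)` at its ends if they differ in colour, and `(1, 1)`, `(0, 2)`, `(2,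
0)` if they agree (`IsLink.hasMonomialOn`). Gluing from `x` to `y`, each change of colour lowers the
total exponent available at the two ends by one, until it is zero
(`ShortestChain.hasMonomialOn_biUnion`).

The geometric part shows that shortest paths of the weak dual give induced chains of triangles, all
on the same vertices (`TrianglePath.isLink`, `TrianglePath.subset`), and that shortest paths between
blocks all have the same passages (`ShortestChain.passage_eq`). Colour classes say nothing if no
3-colouring exists; one is obtained from the combinatorial Nullstellensatz. -/

open Classical in
/-- The part of the graph polynomial that comes from the edges inside `S`. -/
noncomputable def polyOn [Fintype V] (G : SimpleGraph V) (r : V → V → Prop) (S : Finset V) :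
    MvPolynomial V ℤ :=
  ∏ e : V × V with (e.1 ∈ S ∧ e.2 ∈ S) ∧ G.Adj e.1 e.2 ∧ r e.1 e.2, (X e.1 - X e.2)

variable [Fintype V] {G : SimpleGraph V} {r : V → V → Prop}

lemma polyOn_univ : polyOn G r Finset.univ = graphPolynomial G r := by
  classical
  rw [polyOn, graphPolynomial]
  congr 1
  ext e
  simp

open Classical in
lemma polyOn_eq_prod_prod (S : Finset V) :
    polyOn G r S =
      ∏ z ∈ S, ∏ w ∈ S, if G.Adj z w ∧ r z w then (X z - X w : MvPolynomial V ℤ) else 1 := by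
  rw [polyOn, ← Finset.prod_product', ← Finset.prod_filter]
  congr 1
  ext e
  simp [and_assoc]

-- Each edge at `w` enters in one of its two orientations, and the choice costs only a sign. What
-- follows uses coefficients up to a common non-zero factor, so the signs are collected in `ε`.
open Classical in
lemma polyOn_insert (hr : IsOrientation G r) {S : Finset V} {w : V} (hw : w ∉ S) :
    ∃ ε : ℤ, ε ≠ 0 ∧ polyOn G r (insert w S) =
      C ε * (polyOn G r S * ∏ z ∈ S with G.Adj z w, (X z - X w)) := by
  have key : ∀ T : Finset V, ∃ ε : ℤ, ε ≠ 0 ∧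
      (∏ z ∈ T, ((if G.Adj z w ∧ r z w then (X z - X w : MvPolynomial V ℤ) else 1) *
        (if G.Adj w z ∧ r w z then (X w - X z : MvPolynomial V ℤ) else 1))) =
      C ε * ∏ z ∈ T, if G.Adj z w then (X z - X w) else 1 := by
    intro T
    induction T using Finset.induction_on with
    | empty => exact ⟨1, by simp⟩
    | insert z T hz ih =>
      obtain ⟨ε, hε, h⟩ := ih
      rw [Finset.prod_insert hz, Finset.prod_insert hz, h]
      by_cases ha : G.Adj z w
      · rcases hr z w ha with ⟨h1, h2⟩ | ⟨h1, h2⟩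
        · refine ⟨ε, hε, ?_⟩
          simp only [ha, ha.symm, h1, h2, and_self, and_false, if_true, if_false]
          ring
        · refine ⟨-ε, neg_ne_zero.2 hε, ?_⟩
          simp only [ha, ha.symm, h1, h2, and_self, and_false, if_true, if_false, C_neg]
          ring
      · refine ⟨ε, hε, ?_⟩
        have ha' : ¬ G.Adj w z := fun h => ha h.symm
        simp [ha, ha']
  obtain ⟨ε, hε, h⟩ := key S
  refine ⟨ε, hε, ?_⟩
  rw [polyOn_eq_prod_prod, polyOn_eq_prod_prod, Finset.prod_filter, mul_left_comm, ← h,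
    Finset.prod_insert hw]
  simp only [Finset.prod_insert hw, Finset.prod_mul_distrib]
  simp only [SimpleGraph.irrefl, false_and, if_false]
  ring

/-- An edge has two distinct ends, so it cannot lie in both sets, which share only `c`; and no edge
leads from one set to the other away from `c`. -/
lemma polyOn_union {S T : Finset V} [DecidableEq V] {c : V} (hST : ∀ z ∈ S, z ∈ T → z = c)
    (hc : c ∈ S) (hc' : c ∈ T)
    (hedge : ∀ z ∈ S, ∀ w ∈ T, z ≠ c → w ≠ c → ¬ G.Adj z w) :
    polyOn G r (S ∪ T) = polyOn G r S * polyOn G r T := by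
  classical
  rw [polyOn, polyOn, polyOn, ← Finset.prod_union]
  · congr 1
    ext ⟨z, w⟩
    simp only [Finset.mem_filter, Finset.mem_univ, true_and, Finset.mem_union]
    constructor
    · rintro ⟨⟨hz, hw⟩, h⟩
      rw [← or_and_right]
      refine ⟨?_, h⟩
      by_cases h1 : z = c
      · subst h1; tauto
      by_cases h2 : w = c
      · subst h2; tauto
      have e1 := fun a b => hedge z a w b h1 h2 h.1
      have e2 := fun a b => hedge w a z b h2 h1 h.1.symm
      tauto
    · tauto
  · rw [Finset.disjoint_left]
    rintro ⟨z, w⟩ h1 h2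
    simp only [Finset.mem_filter, Finset.mem_univ, true_and] at h1 h2
    exact h1.2.1.ne ((hST z h1.1.1 h2.1.1).trans (hST w h1.1.2 h2.1.2).symm)

lemma polyOn_isHomogeneous (S : Finset V) : ∃ d, (polyOn G r S).IsHomogeneous d := by
  classical
  refine ⟨_, IsHomogeneous.prod _ _ (fun _ => 1) fun e _ => ?_⟩
  exact (isHomogeneous_X _ _).sub (isHomogeneous_X _ _)

lemma polyOn_coeff_eq_zero {S : Finset V} {m : V →₀ ℕ} (hm : coeff m (polyOn G r S) ≠ 0)
    {v : V} (hv : v ∉ S) : m v = 0 := by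
  classical
  by_contra h
  have h1 : v ∈ (polyOn G r S).vars :=
    (mem_vars_iff_mem_support _).2 ⟨m, MvPolynomial.mem_support_iff.2 hm, Finsupp.mem_support_iff.2 h⟩
  have h2 := vars_prod (R := ℤ) (s := Finset.univ.filter fun e : V × V =>
    (e.1 ∈ S ∧ e.2 ∈ S) ∧ G.Adj e.1 e.2 ∧ r e.1 e.2) (fun e => X e.1 - X e.2) h1
  simp only [Finset.mem_biUnion, Finset.mem_filter, Finset.mem_univ, true_and] at h2
  obtain ⟨e, ⟨⟨he1, he2⟩, -⟩, he⟩ := h2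
  have h3 := vars_sub_subset _ he
  simp only [vars_X, Finset.mem_union, Finset.mem_singleton] at h3
  rcases h3 with rfl | rfl <;> contradiction

/-- The polynomial of `S` has a non-vanishing monomial with exponents `i` at `a`, `j` at `b`, and
at most `2` elsewhere. -/
def HasMonomialOn (G : SimpleGraph V) (r : V → V → Prop) (S : Finset V) (a b : V) (i j : ℕ) :
    Prop :=
  ∃ m : V →₀ ℕ, coeff m (polyOn G r S) ≠ 0 ∧ m a = i ∧ m b = j ∧ ∀ v, v ≠ a → v ≠ b → m v ≤ 2

/-- If two monomials multiply to `m + n`, the exponent of any vertex other than `c` comes from one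
factor alone, and homogeneity then fixes the exponent at `c`. So `(m, n)` is the only contributing
pair, and the coefficient is a product of non-zero integers. -/
lemma HasMonomialOn.glue [DecidableEq V] {S T : Finset V} {a b c : V} {i j k l : ℕ}
    (hS : HasMonomialOn G r S a c i k) (hT : HasMonomialOn G r T c b l j) (hkl : k + l ≤ 2)
    (haT : a ∉ T) (hbS : b ∉ S)
    (hST : ∀ z ∈ S, z ∈ T → z = c) (hc : c ∈ S) (hc' : c ∈ T)
    (hedge : ∀ z ∈ S, ∀ w ∈ T, z ≠ c → w ≠ c → ¬ G.Adj z w) :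
    HasMonomialOn G r (S ∪ T) a b i j := by
  obtain ⟨m, hm, hma, hmc, hm2⟩ := hS
  obtain ⟨n, hn, hnc, hnb, hn2⟩ := hT
  refine ⟨m + n, ?_, ?_, ?_, ?_⟩
  · rw [polyOn_union hST hc hc' hedge, coeff_mul, Finset.sum_eq_single (m, n)]
    · exact mul_ne_zero hm hn
    · rintro ⟨m', n'⟩ hmn hne
      by_contra h0
      have hm' := left_ne_zero_of_mul h0
      have hn' := right_ne_zero_of_mul h0
      apply hne
      have hsum : m' + n' = m + n := Finset.HasAntidiagonal.mem_antidiagonal.1 hmn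
      have hoff : ∀ z, z ≠ c → m' z = m z := by
        intro z hz
        have h1 := DFunLike.congr_fun hsum z
        simp only [Finsupp.add_apply] at h1
        by_cases hzS : z ∈ S
        · have hzT : z ∉ T := fun h => hz (hST z hzS h)
          rw [polyOn_coeff_eq_zero hn hzT, polyOn_coeff_eq_zero hn' hzT] at h1
          simpa using h1
        · rw [polyOn_coeff_eq_zero hm hzS, polyOn_coeff_eq_zero hm' hzS]
      obtain ⟨d, hd⟩ := polyOn_isHomogeneous (G := G) (r := r) S
      have hdeg : m'.degree = m.degree := by
        rw [Finsupp.degree_eq_weight_one]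
        exact (hd hm').trans (hd hm).symm
      have hmm : m' = m := by
        rw [Finsupp.degree_eq_sum, Finsupp.degree_eq_sum,
          ← Finset.add_sum_erase _ (fun z => m' z) (Finset.mem_univ c),
          ← Finset.add_sum_erase _ (fun z => m z) (Finset.mem_univ c),
          Finset.sum_congr rfl fun z hz => hoff z (Finset.ne_of_mem_erase hz)] at hdeg
        ext z
        by_cases hz : z = c
        · rw [hz]; exact Nat.add_right_cancel hdeg
        · exact hoff z hz
      subst hmm
      rw [add_left_cancel hsum]
    · intro h
      simp [Finset.HasAntidiagonal.mem_antidiagonal] at h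
  · rw [Finsupp.add_apply, polyOn_coeff_eq_zero hn haT, hma, add_zero]
  · rw [Finsupp.add_apply, polyOn_coeff_eq_zero hm hbS, hnb, zero_add]
  · intro v hva hvb
    rw [Finsupp.add_apply]
    by_cases hvc : v = c
    · subst hvc; omega
    · by_cases hvS : v ∈ S
      · have := polyOn_coeff_eq_zero hn fun h => hvc (hST v hvS h)
        have := hm2 v hva hvc
        omega
      · have := polyOn_coeff_eq_zero hm hvS
        have := hn2 v hvc hvb
        omega

/-- By the combinatorial Nullstellensatz, a non-vanishing monomial with exponents at most `2`
yields a proper `3`-colouring. -/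
lemma coloring_of_coeff_ne_zero (hr : IsOrientation G r) {m : V →₀ ℕ}
    (hm : coeff m (graphPolynomial G r) ≠ 0) (h2 : ∀ v, m v ≤ 2) :
    Nonempty (G.Coloring (Fin 3)) := by
  classical
  obtain ⟨d, hd⟩ := polyOn_isHomogeneous (G := G) (r := r) Finset.univ
  rw [polyOn_univ] at hd
  have hdm : m.degree = d := by
    rw [Finsupp.degree_eq_weight_one]; exact hd hm
  obtain ⟨s, hs, hne⟩ := combinatorial_nullstellensatz_exists_eval_nonzero
    (graphPolynomial G r) m hm (by
      rw [hdm]; exact hd.totalDegree (fun h => hm (by rw [h, coeff_zero])))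
    -- Three values per variable, one more than the largest exponent.
    (fun _ => ({0, 1, 2} : Finset ℤ)) (fun i => by
      have := h2 i
      have h3 : ({0, 1, 2} : Finset ℤ).card = 3 := rfl
      omega)
  have hne' : ∀ u v, G.Adj u v → r u v → s u ≠ s v := by
    intro u v huv hruv he
    apply hne
    rw [graphPolynomial, map_prod]
    exact Finset.prod_eq_zero (i := (u, v)) (by simp [huv, hruv]) (by simp [he])
  have hproper : ∀ u v, G.Adj u v → s u ≠ s v := by
    intro u v huv
    rcases hr u v huv with ⟨h, -⟩ | ⟨h, -⟩
    · exact hne' u v huv h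
    · exact (hne' v u huv.symm h).symm
  refine ⟨SimpleGraph.Coloring.mk (fun v => if s v = 0 then 0 else if s v = 1 then 1 else 2) ?_⟩
  intro u v huv he
  have := hproper u v huv
  have h1 := hs u
  have h2 := hs v
  simp only [Finset.mem_insert, Finset.mem_singleton] at h1 h2
  rcases h1 with h1 | h1 | h1 <;> rcases h2 with h2 | h2 | h2 <;> simp [h1, h2] at he this

end Algebra

/-! ### Eliminating a vertex of an active edge -/


section Coeff

variable {V : Type*}

lemma coeff_mul_X_of_eq_zero {m : V →₀ ℕ} {s : V} (hs : m s = 0) (P : MvPolynomial V ℤ) :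
    coeff m (P * X s) = 0 := by
  classical
  rw [coeff_mul_X']
  simp [hs]

lemma coeff_mul_X_eq {m m' : V →₀ ℕ} {s : V} (h : m = m' + single s 1) (P : MvPolynomial V ℤ) :
    coeff m (P * X s) = coeff m' P := by
  rw [h, coeff_mul_X]

/-- Expand `(u - w)(v - w) = uv - uw - vw + w²`; as `P` is free of `w`, the exponent `k` selects the
terms. The guards `i ≠ 0` and `j ≠ 0` keep the truncated subtractions honest. -/
lemma coeff_attach {P : MvPolynomial V ℤ} {n : V →₀ ℕ} {u v w : V}
    (huv : u ≠ v) (huw : u ≠ w) (hvw : v ≠ w)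
    (hu : n u = 0) (hv : n v = 0) (hw : n w = 0) (hP : ∀ m, m w ≠ 0 → coeff m P = 0) (i j k : ℕ) :
    coeff (n + single u i + single v j + single w k) (P * ((X u - X w) * (X v - X w))) =
      (if k = 0 ∧ i ≠ 0 ∧ j ≠ 0 then coeff (n + single u (i - 1) + single v (j - 1)) P else 0)
      - (if k = 1 ∧ i ≠ 0 then coeff (n + single u (i - 1) + single v j) P else 0)
      - (if k = 1 ∧ j ≠ 0 then coeff (n + single u i + single v (j - 1)) P else 0)
      + (if k = 2 then coeff (n + single u i + single v j) P else 0) := by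
  have hXu : ∀ (Q : MvPolynomial V ℤ) (i j k : ℕ),
      coeff (n + single u i + single v j + single w k) (Q * X u) =
        if i = 0 then 0 else coeff (n + single u (i - 1) + single v j + single w k) Q := by
    rintro Q (_ | i) j k
    · rw [if_pos rfl, coeff_mul_X_of_eq_zero]
      simp [hu, huv, huw]
    · rw [if_neg (by simp), coeff_mul_X_eq]
      rw [Nat.add_sub_cancel, single_add]
      abel
  have hXv : ∀ (Q : MvPolynomial V ℤ) (i j k : ℕ),
      coeff (n + single u i + single v j + single w k) (Q * X v) =
        if j = 0 then 0 else coeff (n + single u i + single v (j - 1) + single w k) Q := by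
    rintro Q i (_ | j) k
    · rw [if_pos rfl, coeff_mul_X_of_eq_zero]
      simp [hv, huv.symm, hvw]
    · rw [if_neg (by simp), coeff_mul_X_eq]
      rw [Nat.add_sub_cancel, single_add]
      abel
  have hXw : ∀ (Q : MvPolynomial V ℤ) (i j k : ℕ),
      coeff (n + single u i + single v j + single w k) (Q * X w) =
        if k = 0 then 0 else coeff (n + single u i + single v j + single w (k - 1)) Q := by
    rintro Q i j (_ | k)
    · rw [if_pos rfl, coeff_mul_X_of_eq_zero]
      simp [hw, huw.symm, hvw.symm]
    · rw [if_neg (by simp), coeff_mul_X_eq]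
      rw [Nat.add_sub_cancel, single_add]
      abel
  have h0 : ∀ i j k : ℕ, coeff (n + single u i + single v j + single w k) P =
      if k = 0 then coeff (n + single u i + single v j) P else 0 := by
    rintro i j (_ | k)
    · simp
    · rw [if_neg (by simp)]
      exact hP _ (by simp)
  have hexp : P * ((X u - X w) * (X v - X w)) =
      P * X u * X v - P * X u * X w - P * X v * X w + P * X w * X w := by ring
  rw [hexp, coeff_add, coeff_sub, coeff_sub, hXv, hXw, hXw, hXw, hXw]
  simp only [hXu, hXv, h0]
  rcases k with _ | _ | _ | k <;> rcases i with _ | i <;> rcases j with _ | j <;> simp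

end Coeff

/-! ### Chains of triangles -/

section Strip

variable {V : Type*}

open Classical in
/-- `Strip G a S u v`: the subgraph of `G` induced by `S` is a chain of triangles that starts at a
vertex `a`, and `uv` is an edge of its last triangle. -/
inductive Strip (G : SimpleGraph V) (a : V) : Finset V → V → V → Prop
  | triangle {u v : V} : G.Adj a u → G.Adj a v → G.Adj u v → Strip G a {a, u, v} u v
  | attach {S : Finset V} {u v w : V} : Strip G a S u v → w ∉ S → G.Adj u w → G.Adj v w →
      (∀ z ∈ S, G.Adj z w → z = u ∨ z = v) → Strip G a (insert w S) v w
  | swap {S : Finset V} {u v : V} : Strip G a S u v → Strip G a S v u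

/-- The coefficients at the monomials with exponents `(0; 2, 1)`, `(0; 1, 2)`, `(1; 2, 0)`,
`(1; 1, 1)`, `(1; 0, 2)` in `(a; u, v)`, depending on which of the vertices of the edge `uv` has the
colour of `a`. -/
def StripCase (G : SimpleGraph V) (a u v : V) (A B R₂ R₁ R₀ : ℤ) : Prop :=
  ((∀ C : G.Coloring (Fin 3), C a = C u) ∧ A ≠ 0 ∧ B = 0 ∧ R₂ ≠ 0 ∧ R₁ = -R₂ ∧ R₀ = 0) ∨
  ((∀ C : G.Coloring (Fin 3), C a = C v) ∧ A = 0 ∧ B ≠ 0 ∧ R₂ = 0 ∧ R₁ = -R₀ ∧ R₀ ≠ 0) ∨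
  ((∀ C : G.Coloring (Fin 3), C a ≠ C u ∧ C a ≠ C v) ∧ A ≠ 0 ∧ B = -A ∧ R₂ ≠ 0 ∧ R₁ = 0 ∧ R₀ = -R₂)

lemma StripCase.swap {G : SimpleGraph V} {a u v : V} {A B R₂ R₁ R₀ : ℤ}
    (h : StripCase G a u v A B R₂ R₁ R₀) : StripCase G a v u B A R₀ R₁ R₂ := by
  rcases h with ⟨h, h1, h2, h3, h4, h5⟩ | ⟨h, h1, h2, h3, h4, h5⟩ | ⟨h, h1, h2, h3, h4, h5⟩
  · exact Or.inr (Or.inl ⟨h, h2, h1, h5, h4, h3⟩)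
  · exact Or.inl ⟨h, h2, h1, h5, h4, h3⟩
  · refine Or.inr (Or.inr ⟨fun C => (h C).symm, ?_, ?_, ?_, h4, ?_⟩) <;> omega

/-- Up to `ε`, the map `(A, B) ↦ (-(A + B), A)` has order three, and so has its analogue on `R₂, R₁,
R₀`, whose sum is zero. The three cases are the phases of this period, and the forced colours run
through them in the same order. -/
lemma StripCase.attach {G : SimpleGraph V} {a u v w : V} {A B R₂ R₁ R₀ : ℤ}
    (huv : G.Adj u v) (huw : G.Adj u w) (hvw : G.Adj v w)
    (h : StripCase G a u v A B R₂ R₁ R₀) {ε : ℤ} (hε : ε ≠ 0) :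
    StripCase G a v w (ε * -(A + B)) (ε * A) (ε * R₁) (ε * -(R₁ + R₂)) (ε * R₂) := by
  rcases h with ⟨h, h1, h2, h3, h4, h5⟩ | ⟨h, h1, h2, h3, h4, h5⟩ | ⟨h, h1, h2, h3, h4, h5⟩
  · refine Or.inr (Or.inr ⟨fun C => ?_, ?_, ?_, ?_, ?_, ?_⟩)
    · rw [h C]; exact ⟨C.valid huv, C.valid huw⟩
    · simp [h2, h1, hε]
    · simp [h2]
    · simp [h4, h3, hε]
    · simp [h4]
    · simp [h4]
  · refine Or.inl ⟨h, ?_, ?_, ?_, ?_, ?_⟩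
    · simp [h2, h1, hε]
    · simp [h1]
    · simp [h4, h5, hε]
    · simp [h3]
    · simp [h3]
  · refine Or.inr (Or.inl ⟨fun C => ?_, ?_, ?_, ?_, ?_, ?_⟩)
    -- With three colours, `a` and `w` both get the one that is missing on `uv`.
    · have e1 := h C
      have e2 := C.valid huv
      have e3 := C.valid huw
      have e4 := C.valid hvw
      omega
    · simp [h2]
    · simp [h1, hε]
    · simp [h4]
    · simp [h4]
    · simp [h3, hε]

/-- The coefficients that are tracked along a chain of triangles. -/
structure StripState [Fintype V] (G : SimpleGraph V) (r : V → V → Prop) (a : V) (S : Finset V)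
    (u v : V) (n : V →₀ ℕ) : Prop where
  mem_a : a ∈ S
  mem_u : u ∈ S
  mem_v : v ∈ S
  a_ne_u : a ≠ u
  a_ne_v : a ≠ v
  adj : G.Adj u v
  at_a : n a = 0
  at_u : n u = 0
  at_v : n v = 0
  le_two : ∀ z, n z ≤ 2
  off : ∀ z, z ∉ S → n z = 0
  coeff_two : coeff (n + single a 2 + single u 1 + single v 0) (polyOn G r S) ≠ 0
  coeff_two' : coeff (n + single a 2 + single u 0 + single v 1) (polyOn G r S) =
    - coeff (n + single a 2 + single u 1 + single v 0) (polyOn G r S)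
  cases : StripCase G a u v (coeff (n + single a 0 + single u 2 + single v 1) (polyOn G r S))
    (coeff (n + single a 0 + single u 1 + single v 2) (polyOn G r S))
    (coeff (n + single a 1 + single u 2 + single v 0) (polyOn G r S))
    (coeff (n + single a 1 + single u 1 + single v 1) (polyOn G r S))
    (coeff (n + single a 1 + single u 0 + single v 2) (polyOn G r S))

variable [Fintype V] {G : SimpleGraph V} {r : V → V → Prop}

lemma StripState.swap {a u v : V} {S : Finset V} {n : V →₀ ℕ} (h : StripState G r a S u v n) :
    StripState G r a S v u n := by
  have hc : ∀ i j k, n + single a k + single v i + single u j =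
      n + single a k + single u j + single v i := fun i j k => add_right_comm _ _ _
  refine ⟨h.mem_a, h.mem_v, h.mem_u, h.a_ne_v, h.a_ne_u, h.adj.symm, h.at_a, h.at_v, h.at_u,
    h.le_two, h.off, ?_, ?_, ?_⟩
  · rw [hc, h.coeff_two']
    exact neg_ne_zero.2 h.coeff_two
  · rw [hc, hc, h.coeff_two', neg_neg]
  · simp only [hc]
    exact h.cases.swap

open Classical in
lemma polyOn_attach (hr : IsOrientation G r) {S : Finset V} {u v w : V} (huv : u ≠ v)
    (hu : u ∈ S) (hv : v ∈ S) (hw : w ∉ S) (huw : G.Adj u w) (hvw : G.Adj v w)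
    (hS : ∀ z ∈ S, G.Adj z w → z = u ∨ z = v) :
    ∃ ε : ℤ, ε ≠ 0 ∧ polyOn G r (insert w S) =
      C ε * (polyOn G r S * ((X u - X w) * (X v - X w))) := by
  obtain ⟨ε, hε, h⟩ := polyOn_insert hr hw
  refine ⟨ε, hε, ?_⟩
  have : (S.filter fun z => G.Adj z w) = {u, v} := by
    ext z
    simp only [Finset.mem_filter, Finset.mem_insert, Finset.mem_singleton]
    constructor
    · exact fun h => hS z h.1 h.2
    · rintro (rfl | rfl) <;> exact ⟨by assumption, by assumption⟩
  rw [h, this, Finset.prod_pair huv]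

-- The vertex `u` is left behind with exponent `2`. As `w` brings two edges, degree three remains
-- for `a`, `v`, `w`.
open Classical in
lemma StripState.attach (hr : IsOrientation G r) {a u v w : V} {S : Finset V} {n : V →₀ ℕ}
    (h : StripState G r a S u v n) (hw : w ∉ S) (huw : G.Adj u w) (hvw : G.Adj v w)
    (hS : ∀ z ∈ S, G.Adj z w → z = u ∨ z = v) :
    StripState G r a (insert w S) v w (n + single u 2) := by
  have haw : a ≠ w := fun e => hw (e ▸ h.mem_a)
  obtain ⟨ε, hε, hpoly⟩ := polyOn_attach hr h.adj.ne h.mem_u h.mem_v hw huw hvw hS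
  have hc : ∀ i j k, coeff (n + single u 2 + single a i + single v j + single w k)
      (polyOn G r (insert w S)) = ε * coeff (n + single a i + single u 2 + single v j + single w k)
        (polyOn G r S * ((X u - X w) * (X v - X w))) := by
    intro i j k
    rw [hpoly, coeff_C_mul, add_right_comm n (single u 2)]
  have hc' := fun i j k => coeff_attach (P := polyOn G r S) (n := n + single a i) h.adj.ne huw.ne
    hvw.ne (by simp [h.at_u, h.a_ne_u.symm]) (by simp [h.at_v, h.a_ne_v.symm])
    (by simp [h.off w hw, haw.symm]) (fun m hm => by
      by_contra h0
      exact hm (polyOn_coeff_eq_zero h0 hw)) 2 j k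
  refine ⟨by simp [h.mem_a], by simp [h.mem_v], by simp, h.a_ne_v, haw, hvw, ?_, ?_, ?_, ?_, ?_, ?_,
    ?_, ?_⟩
  · simp [h.at_a, h.a_ne_u]
  · simp [h.at_v, h.adj.ne']
  · simp [h.off w hw, huw.ne']
  · intro z
    by_cases hz : z = u
    · subst hz; simp [h.at_u]
    · simp [hz, h.le_two z]
  · intro z hz
    simp only [Finset.mem_insert, not_or] at hz
    have : z ≠ u := fun e => hz.2 (e ▸ h.mem_u)
    simp [h.off z hz.2, this]
  · rw [hc, hc']
    simpa [hε] using h.coeff_two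
  · rw [hc, hc, hc', hc']
    simp
  · simp only [hc, hc']
    have := h.cases.attach h.adj huw hvw hε
    convert this using 1 <;> simp only [one_ne_zero, ne_eq, OfNat.ofNat_ne_zero, not_false_eq_true,
      and_self, and_true, and_false, if_true, if_false, not_true_eq_false,
      OfNat.one_ne_ofNat, OfNat.ofNat_ne_one, OfNat.zero_ne_ofNat, zero_ne_one,
      Nat.add_one_sub_one, Nat.reduceSub, Nat.sub_self] <;> ring

open Classical in
lemma StripState.triangle (hr : IsOrientation G r) {a u v : V} (hau : G.Adj a u) (hav : G.Adj a v)
    (huv : G.Adj u v) : StripState G r a {a, u, v} u v 0 := by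
  have h1 : polyOn G r {a} = 1 := by
    rw [polyOn_eq_prod_prod]
    simp
  obtain ⟨ε₁, hε₁, h2⟩ := polyOn_insert (S := {a}) (w := u) hr (by simpa using hau.ne')
  have hf : (({a} : Finset V).filter fun z => G.Adj z u) = {a} := by
    ext z
    simp only [Finset.mem_filter, Finset.mem_singleton]
    exact ⟨fun h => h.1, fun h => ⟨h, h ▸ hau⟩⟩
  rw [h1, one_mul, hf, Finset.prod_singleton] at h2
  -- The triangle is built by attaching `v` to the edge `ua`, so that `coeff_attach` also computes
  -- its coefficients.
  obtain ⟨ε₂, hε₂, h3⟩ := polyOn_attach (S := {u, a}) (u := a) (v := u) (w := v) hr hau.ne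
    (by simp) (by simp) (by simp [huv.ne', hav.ne']) hav huv (by simp)
  have hset : insert v ({u, a} : Finset V) = {a, u, v} := by
    ext z; simp; tauto
  rw [hset, h2] at h3
  set ε := ε₂ * ε₁ with hεdef
  have hε : ε ≠ 0 := mul_ne_zero hε₂ hε₁
  have h4 : polyOn G r {a, u, v} = C ε * ((X a - X u) * ((X a - X v) * (X u - X v))) := by
    rw [h3, C_mul]; ring
  have hE : ∀ i j : ℕ, coeff (0 + single a i + single u j) (X a - X u : MvPolynomial V ℤ) =
      (if i = 1 ∧ j = 0 then 1 else 0) - (if i = 0 ∧ j = 1 then 1 else 0) := by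
    intro i j
    rw [coeff_sub, coeff_X, coeff_X]
    congr 1
    · congr 1
      rw [eq_iff_iff, zero_add, Finsupp.ext_iff]
      constructor
      · intro h
        have e1 := h a
        have e2 := h u
        simp [hau.ne, hau.ne'] at e1 e2
        omega
      · rintro ⟨rfl, rfl⟩; simp
    · congr 1
      rw [eq_iff_iff, zero_add, Finsupp.ext_iff]
      constructor
      · intro h
        have e1 := h a
        have e2 := h u
        simp [hau.ne, hau.ne'] at e1 e2
        omega
      · rintro ⟨rfl, rfl⟩; simp
  have hc : ∀ i j k : ℕ, coeff (0 + single a i + single u j + single v k)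
      (polyOn G r {a, u, v}) = ε * coeff (0 + single a i + single u j + single v k)
        ((X a - X u) * ((X a - X v) * (X u - X v))) := by
    intro i j k
    rw [h4, coeff_C_mul]
  have hc' := fun i j k => coeff_attach (P := (X a - X u : MvPolynomial V ℤ)) (n := 0) hau.ne hav.ne
    huv.ne rfl rfl rfl (fun m hm => by
      rw [coeff_sub, coeff_X, coeff_X, if_neg, if_neg, sub_zero]
      · rintro rfl; simp [huv.ne'] at hm
      · rintro rfl; simp [hav.ne'] at hm) i j k
  refine ⟨by simp, by simp, by simp, hau.ne, hav.ne, huv, rfl, rfl, rfl, by simp, by simp, ?_, ?_,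
    ?_⟩
  · simp only [hc, hc', hE]
    simp [hε]
  · simp only [hc, hc', hE]
    simp
  · simp only [hc, hc', hE]
    refine Or.inr (Or.inr ⟨fun C => ⟨C.valid hau, C.valid hav⟩, ?_⟩)
    simp [hε]

lemma Strip.exists_state (hr : IsOrientation G r) {a u v : V} {S : Finset V}
    (h : Strip G a S u v) : ∃ n, StripState G r a S u v n := by
  induction h with
  | triangle h1 h2 h3 => exact ⟨0, .triangle hr h1 h2 h3⟩
  | attach _ h1 h2 h3 h4 ih =>
    obtain ⟨n, hn⟩ := ih
    exact ⟨_, hn.attach hr h1 h2 h3 h4⟩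
  | swap _ ih =>
    obtain ⟨n, hn⟩ := ih
    exact ⟨n, hn.swap⟩

open Classical in
/-- `S` induces an edge `ab`, or a chain of triangles between `a` and `b`. -/
def IsLink (G : SimpleGraph V) (S : Finset V) (a b : V) : Prop :=
  (G.Adj a b ∧ S = {a, b}) ∨ ∃ v, Strip G a S v b

lemma StripState.hasMonomialOn {a v b : V} {S : Finset V} {n : V →₀ ℕ}
    (h : StripState G r a S v b n) {i j k : ℕ} (hj : j ≤ 2)
    (hne : coeff (n + single a i + single v j + single b k) (polyOn G r S) ≠ 0) :
    HasMonomialOn G r S a b i k := by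
  refine ⟨_, hne, ?_, ?_, ?_⟩
  · simp [h.at_a, h.a_ne_u, h.a_ne_v]
  · simp [h.at_v, h.a_ne_v.symm, h.adj.ne']
  · intro z hza hzb
    by_cases hz : z = v
    · subst hz; simpa [h.at_u, hza, hzb] using hj
    · simpa [hz, hza, hzb] using h.le_two z

/-- The monomials of the polynomial of a link, according to the colours of its ends. -/
lemma IsLink.hasMonomialOn (hr : IsOrientation G r) {S : Finset V} {a b : V} (h : IsLink G S a b) :
    ((∀ C : G.Coloring (Fin 3), C a ≠ C b) ∧ HasMonomialOn G r S a b 0 1 ∧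
      HasMonomialOn G r S a b 1 0) ∨
    ((∀ C : G.Coloring (Fin 3), C a = C b) ∧ HasMonomialOn G r S a b 1 1 ∧
      HasMonomialOn G r S a b 0 2 ∧ HasMonomialOn G r S a b 2 0) := by
  classical
  rcases h with ⟨hab, rfl⟩ | ⟨v, hS⟩
  · left
    have h1 : polyOn G r {b} = 1 := by
      rw [polyOn_eq_prod_prod]
      simp
    obtain ⟨ε, hε, h2⟩ := polyOn_insert (S := {b}) (w := a) hr (by simpa using hab.ne)
    have hf : (({b} : Finset V).filter fun z => G.Adj z a) = {b} := by
      ext z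
      simp only [Finset.mem_filter, Finset.mem_singleton]
      exact ⟨fun h => h.1, fun h => ⟨h, h ▸ hab.symm⟩⟩
    rw [h1, one_mul, hf, Finset.prod_singleton] at h2
    have e1 : single a 1 ≠ single b 1 := fun h => by
      have := DFunLike.congr_fun h a
      simp [hab.ne'] at this
    refine ⟨fun C => C.valid hab, ⟨single b 1, ?_, ?_, ?_, ?_⟩, ⟨single a 1, ?_, ?_, ?_, ?_⟩⟩
    · rw [h2, coeff_C_mul, coeff_sub, coeff_X, coeff_X]
      simp [hε, e1]
    · simp [hab.ne]
    · simp
    · intro v _ hv; simp [hv]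
    · rw [h2, coeff_C_mul, coeff_sub, coeff_X, coeff_X]
      simp [hε, e1.symm]
    · simp
    · simp [hab.ne']
    · intro v hv _; simp [hv]
  · obtain ⟨n, hn⟩ := hS.exists_state hr
    -- At `(a, b)`, the coefficients `A` and `R₂` have exponents `(0, 1)` and `(1, 0)`, while `R₁`,
    -- `B` and `coeff_two` have `(1, 1)`, `(0, 2)` and `(2, 0)`.
    rcases hn.cases with ⟨h, h1, h2, h3, h4, h5⟩ | ⟨h, h1, h2, h3, h4, h5⟩ |
      ⟨h, h1, h2, h3, h4, h5⟩
    · left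
      refine ⟨fun C => ?_, hn.hasMonomialOn le_rfl h1, hn.hasMonomialOn le_rfl h3⟩
      rw [h C]; exact C.valid hn.adj
    · right
      refine ⟨h, hn.hasMonomialOn one_le_two (k := 1) ?_, hn.hasMonomialOn one_le_two h2,
        hn.hasMonomialOn one_le_two hn.coeff_two⟩
      rw [h4]; exact neg_ne_zero.2 h5
    · left
      exact ⟨fun C => (h C).2, hn.hasMonomialOn le_rfl h1, hn.hasMonomialOn le_rfl h3⟩

end Strip

/-! ### Sides of a chord -/

section Sides

variable {V : Type*} {G : SimpleGraph V}

lemma between_comm {pos : V → ℕ} {u w v : V} : Between pos u w v ↔ Between pos v w u := by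
  unfold Between; tauto

namespace OuterplaneDrawing

variable (D : OuterplaneDrawing G)
include D

lemma pos_ne {u v : V} (h : u ≠ v) : D.pos u ≠ D.pos v := D.pos_injective.ne h

lemma between_of_adj {u v w z : V} (huv : G.Adj u v) (hwz : G.Adj w z) (hw : Between D.pos u w v)
    (hzu : z ≠ u) (hzv : z ≠ v) : Between D.pos u z v := by
  have h1 := D.pos_ne hzu
  have h2 := D.pos_ne hzv
  have e1 := D.noncrossing u w v z huv hwz
  have e2 := D.noncrossing z u w v hwz.symm huv
  have e3 := D.noncrossing v w u z huv.symm hwz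
  have e4 := D.noncrossing z v w u hwz.symm huv.symm
  unfold Between at *
  omega

lemma between_iff_of_adj {u v w z : V} (huv : G.Adj u v) (hwz : G.Adj w z) (hwu : w ≠ u)
    (hwv : w ≠ v) (hzu : z ≠ u) (hzv : z ≠ v) :
    Between D.pos u w v ↔ Between D.pos u z v :=
  ⟨fun h => D.between_of_adj huv hwz h hzu hzv, fun h => D.between_of_adj huv hwz.symm h hwu hwv⟩

/-- If both apexes were on one side of `uv`, an edge from one of them would cross an edge from the
other. -/
lemma between_iff_not_between {u v t w : V} (huv : G.Adj u v) (hut : G.Adj u t) (hvt : G.Adj v t)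
    (huw : G.Adj u w) (hvw : G.Adj v w) (htw : t ≠ w) :
    Between D.pos u t v ↔ ¬ Between D.pos u w v := by
  have h1 := D.pos_ne huv.ne
  have h2 := D.pos_ne hut.ne
  have h3 := D.pos_ne hvt.ne
  have h4 := D.pos_ne huw.ne
  have h5 := D.pos_ne hvw.ne
  have h6 := D.pos_ne htw
  unfold Between
  constructor
  · intro ht hw
    have a1 := D.noncrossing u t w v huw hvt.symm
    have a2 := D.noncrossing u w t v hut hvw.symm
    have a3 := D.noncrossing v t w u hvw hut.symm
    have a4 := D.noncrossing v w t u hvt huw.symm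
    omega
  · intro hw
    by_contra ht
    rcases Nat.lt_or_gt_of_ne h1 with h | h
    · have b1 := D.noncrossing t w u v hut.symm hvw.symm
      have b3 := D.noncrossing w t u v huw.symm hvt.symm
      have c1 := D.noncrossing u v t w hut hvw
      have c2 := D.noncrossing u v w t huw hvt
      have d1 := D.noncrossing t u v w hvt.symm huw
      have d3 := D.noncrossing w u v t hvw.symm hut
      omega
    · have b2 := D.noncrossing t w v u hvt.symm huw.symm
      have b4 := D.noncrossing w t v u hvw.symm hut.symm
      have c3 := D.noncrossing v u t w hvt huw
      have c4 := D.noncrossing v u w t hvw hut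
      have d2 := D.noncrossing t v u w hut.symm hvw
      have d4 := D.noncrossing w v u t huw.symm hvt
      omega

/-- If the chord `tu` cuts `z` off from `v`, then `z` lies on the arc from `t` to `u` that avoids
`v`, hence on the side of `t` with respect to `uv`. This moves a side from one edge of a triangle to
the next. -/
lemma between_rotate {t u v z : V} (htu : t ≠ u) (htv : t ≠ v) (huv : u ≠ v) (hzt : z ≠ t)
    (hzu : z ≠ u) (hzv : z ≠ v) (h : Between D.pos t z u ↔ ¬ Between D.pos t v u) :
    Between D.pos u z v ↔ Between D.pos u t v := by
  have h1 := D.pos_ne htu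
  have h2 := D.pos_ne htv
  have h3 := D.pos_ne huv
  have h4 := D.pos_ne hzt
  have h5 := D.pos_ne hzu
  have h6 := D.pos_ne hzv
  unfold Between at *
  omega

end OuterplaneDrawing

end Sides

/-! ### Triangular faces -/

section Faces

variable {V : Type*} {G : SimpleGraph V} {D : OuterplaneDrawing G}

lemma exists_third {F : Finset V} (hF : F.card = 3) {u v : V} (hu : u ∈ F) (hv : v ∈ F)
    (huv : u ≠ v) : ∃ t ∈ F, t ≠ u ∧ t ≠ v ∧ ∀ z ∈ F, z = u ∨ z = v ∨ z = t := by
  classical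
  have h1 : ((F.erase u).erase v).card = 1 := by
    rw [Finset.card_erase_of_mem (Finset.mem_erase.2 ⟨huv.symm, hv⟩), Finset.card_erase_of_mem hu,
      hF]
  obtain ⟨t, ht⟩ := Finset.card_eq_one.1 h1
  have hm : ∀ z, z ∈ (F.erase u).erase v ↔ z = t := fun z => by rw [ht, Finset.mem_singleton]
  have h2 := (hm t).2 rfl
  simp only [Finset.mem_erase] at h2 hm
  refine ⟨t, h2.2.2, h2.2.1, h2.1, fun z hz => ?_⟩
  have := hm z
  tauto

lemma IsInnerFace.card_eq_three (hG : IsNearTriangulation D) {B : Set V} {F : Finset V}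
    (hF : IsInnerFace D B F) : F.card = 3 :=
  hG F ⟨Set.subset_univ _, hF.2⟩

/-- The third vertex lies on one of the two arcs between `u` and `v`, so the other arc is empty. -/
lemma IsInnerFace.adj {B : Set V} {F : Finset V}
    (hF : IsInnerFace D B F) (h3 : F.card = 3) {u v : V} (hu : u ∈ F) (hv : v ∈ F) (huv : u ≠ v) :
    G.Adj u v := by
  rw [hF.2.2 u hu v hv huv]
  obtain ⟨t, -, -, -, hz⟩ := exists_third h3 hu hv huv
  by_cases ht : Between D.pos u t v
  · right
    intro w hw hwu hwv
    rcases hz w hw with rfl | rfl | rfl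
    · contradiction
    · contradiction
    · exact ht
  · left
    intro w hw
    rcases hz w hw with rfl | rfl | rfl
    · unfold Between; omega
    · unfold Between; omega
    · exact ht

/-- A chain of triangles `F 0, …, F k` in which successive triangles share an edge, without detours,
that leads from `a` to `b`. -/
structure TrianglePath (G : SimpleGraph V) (a b : V) (F : ℕ → Finset V) (k : ℕ) : Prop where
  pos : 0 < k
  card : ∀ i ≤ k, (F i).card = 3
  adj : ∀ i ≤ k, ∀ u ∈ F i, ∀ v ∈ F i, u ≠ v → G.Adj u v
  ne : ∀ i < k, F i ≠ F (i + 1)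
  share : ∀ i < k, ∃ u v, u ≠ v ∧ u ∈ F i ∧ v ∈ F i ∧ u ∈ F (i + 1) ∧ v ∈ F (i + 1)
  skip : ∀ i, i + 2 ≤ k → F i ≠ F (i + 2)
  mem_left : ∀ i ≤ k, (a ∈ F i ↔ i = 0)
  mem_right : ∀ i ≤ k, (b ∈ F i ↔ i = k)

lemma third_ne {F F' : Finset V} {u v s t : V} (hne : F ≠ F') (hu : u ∈ F)
    (hv : v ∈ F) (hu' : u ∈ F') (hv' : v ∈ F') (hs : s ∈ F) (ht : t ∈ F')
    (hz : ∀ z ∈ F, z = u ∨ z = v ∨ z = s) (hz' : ∀ z ∈ F', z = u ∨ z = v ∨ z = t) : s ≠ t := by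
  rintro rfl
  apply hne
  ext z
  constructor
  · intro h
    rcases hz z h with rfl | rfl | rfl <;> assumption
  · intro h
    rcases hz' z h with rfl | rfl | rfl <;> assumption

namespace TrianglePath

variable {a b : V} {F : ℕ → Finset V} {k : ℕ}

lemma reverse (h : TrianglePath G a b F k) : TrianglePath G b a (fun i => F (k - i)) k := by
  refine ⟨h.pos, fun i _ => h.card _ (by omega), fun i _ => h.adj _ (by omega), ?_, ?_, ?_, ?_, ?_⟩
  · intro i hi
    have := h.ne (k - (i + 1)) (by omega)
    rw [show k - (i + 1) + 1 = k - i by omega] at this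
    exact this.symm
  · intro i hi
    obtain ⟨u, v, huv, h1, h2, h3, h4⟩ := h.share (k - (i + 1)) (by omega)
    rw [show k - (i + 1) + 1 = k - i by omega] at h3 h4
    exact ⟨u, v, huv, h3, h4, h1, h2⟩
  · intro i hi
    have := h.skip (k - (i + 2)) (by omega)
    rw [show k - (i + 2) + 2 = k - i by omega] at this
    exact this.symm
  · intro i hi
    rw [h.mem_right _ (by omega)]
    omega
  · intro i hi
    rw [h.mem_left _ (by omega)]
    omega

include D in
/-- The two triangles at a shared edge lie on different sides of it. -/
lemma opposite (h : TrianglePath G a b F k) {i : ℕ} (hi : i < k) {u v s t : V} (huv : u ≠ v)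
    (hu : u ∈ F i) (hv : v ∈ F i) (hu' : u ∈ F (i + 1)) (hv' : v ∈ F (i + 1)) (hs : s ∈ F i)
    (hsu : s ≠ u) (hsv : s ≠ v) (ht : t ∈ F (i + 1)) (htu : t ≠ u) (htv : t ≠ v) :
    Between D.pos u s v ↔ ¬ Between D.pos u t v := by
  obtain ⟨s', -, -, -, hz⟩ := exists_third (h.card i hi.le) hu hv huv
  obtain ⟨t', -, -, -, hz'⟩ := exists_third (h.card (i + 1) hi) hu' hv' huv
  obtain rfl : s = s' := by have := hz s hs; tauto
  obtain rfl : t = t' := by have := hz' t ht; tauto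
  have hst := third_ne (h.ne i hi) hu hv hu' hv' hs ht hz hz'
  exact D.between_iff_not_between (h.adj i hi.le u hu v hv huv) (h.adj i hi.le u hu s hs hsu.symm)
    (h.adj i hi.le v hv s hs hsv.symm) (h.adj _ hi u hu' t ht htu.symm)
    (h.adj _ hi v hv' t ht htv.symm) hst

include D in
/-- The edges that a triangle shares with its predecessor and with its successor are different. -/
lemma turn (h : TrianglePath G a b F k) {i : ℕ} (hi : i + 2 ≤ k) {u v : V} (huv : u ≠ v)
    (hu : u ∈ F (i + 1)) (hv : v ∈ F (i + 1)) (hu' : u ∈ F (i + 2)) (hv' : v ∈ F (i + 2)) :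
    ∃ t, t ∈ F i ∧ t ∈ F (i + 1) ∧ t ≠ u ∧ t ≠ v ∧ (∀ z ∈ F (i + 1), z = u ∨ z = v ∨ z = t) ∧
      (u ∈ F i ∨ v ∈ F i) := by
  obtain ⟨t, ht, htu, htv, hz⟩ := exists_third (h.card (i + 1) (by omega)) hu hv huv
  obtain ⟨p, q, hpq, hp, hq, hp', hq'⟩ := h.share i (by omega)
  -- Otherwise three successive triangles contain `uv`, and their distinct apexes would lie pairwise
  -- on opposite sides of it.
  have hboth : ¬ (u ∈ F i ∧ v ∈ F i) := by
    rintro ⟨hu0, hv0⟩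
    obtain ⟨s, hs, hsu, hsv, hzs⟩ := exists_third (h.card i (by omega)) hu0 hv0 huv
    obtain ⟨w, hw, hwu, hwv, hzw⟩ := exists_third (h.card (i + 2) (by omega)) hu' hv' huv
    have h1 := h.opposite (D := D) (i := i) (by omega) huv hu0 hv0 hu hv hs hsu hsv ht htu htv
    have h2 := h.opposite (D := D) (i := i + 1) (by omega) huv hu hv hu' hv' ht htu htv hw hwu hwv
    have hsw := third_ne (h.skip i hi) hu0 hv0 hu' hv' hs hw hzs hzw
    have h3 := D.between_iff_not_between (h.adj i (by omega) u hu0 v hv0 huv)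
      (h.adj i (by omega) u hu0 s hs hsu.symm) (h.adj i (by omega) v hv0 s hs hsv.symm)
      (h.adj _ hi u hu' w hw hwu.symm) (h.adj _ hi v hv' w hw hwv.symm) hsw
    tauto
  refine ⟨t, ?_, ht, htu, htv, hz, ?_⟩
  · rcases hz p hp' with rfl | rfl | rfl <;> rcases hz q hq' with rfl | rfl | rfl <;> tauto
  · rcases hz p hp' with rfl | rfl | rfl <;> rcases hz q hq' with rfl | rfl | rfl <;> tauto

include D in
/-- The triangles up to `F i` lie on one side of an edge shared by `F i` and `F (i + 1)`. -/
lemma side (h : TrianglePath G a b F k) {i : ℕ} (hi : i < k) :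
    ∀ {u v t : V}, u ≠ v → u ∈ F i → v ∈ F i → u ∈ F (i + 1) → v ∈ F (i + 1) → t ∈ F i →
      t ≠ u → t ≠ v → ∀ j ≤ i, ∀ z ∈ F j, z ≠ u → z ≠ v →
        (Between D.pos u z v ↔ Between D.pos u t v) := by
  induction i with
  | zero =>
    intro u v t huv hu hv hu' hv' ht htu htv j hj z hzj hzu hzv
    obtain rfl : j = 0 := by omega
    obtain ⟨t', -, -, -, hz⟩ := exists_third (h.card 0 (by omega)) hu hv huv
    have e1 := hz t ht
    have e2 := hz z hzj
    obtain rfl : z = t := by grind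
    rfl
  | succ i ih =>
    have aux : ∀ {u v t : V}, u ≠ v → u ∈ F (i + 1) → v ∈ F (i + 1) → t ∈ F (i + 1) →
        t ∈ F i → u ∈ F i → t ≠ u → t ≠ v → (∀ z ∈ F (i + 1), z = u ∨ z = v ∨ z = t) →
        ∀ j ≤ i + 1, ∀ z ∈ F j, z ≠ u → z ≠ v →
          (Between D.pos u z v ↔ Between D.pos u t v) := by
      intro u v t huv hu hv ht ht0 hu0 htu htv hthree j hj z hzj hzu hzv
      by_cases hzt : z = t
      · rw [hzt]
      obtain rfl | hj' := Nat.eq_or_lt_of_le hj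
      · have := hthree z hzj
        tauto
      obtain ⟨s, hs, hst, hsu, -⟩ := exists_third (h.card i (by omega)) ht0 hu0 htu
      -- Earlier vertices lie on the side of `s` of the entry edge `tu`, and `v` lies beyond it;
      -- rotation about the triangle passes to the exit edge `uv`.
      have h1 := ih (by omega) htu ht0 hu0 ht hu hs hst hsu j (by omega) z hzj hzt hzu
      have h2 := h.opposite (D := D) (i := i) (by omega) htu ht0 hu0 ht hu hs hst hsu hv htv.symm
        huv.symm
      exact D.between_rotate htu htv huv hzt hzu hzv (h1.trans h2)
    intro u v t huv hu hv hu' hv' ht htu htv j hj z hzj hzu hzv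
    obtain ⟨t', ht0, -, -, -, hthree, hor⟩ := h.turn (D := D) (i := i) (by omega) huv hu hv hu' hv'
    obtain rfl : t = t' := by have := hthree t ht; tauto
    rcases hor with hu0 | hv0
    · exact aux huv hu hv ht ht0 hu0 htu htv hthree j hj z hzj hzu hzv
    · rw [between_comm, between_comm (w := t)]
      exact aux huv.symm hv hu ht ht0 hv0 htv htu (fun z hz => by have := hthree z hz; tauto)
        j hj z hzj hzv hzu

-- The earlier triangles lie on one side of `pq` and `v` on the other. Hence `v` is new, and an edge
-- from `v` to an earlier vertex other than `p`, `q` would cross `pq`; this makes the chain induced.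
open Classical in
include D in
lemma strip_attach (h : TrianglePath G a b F k) {i : ℕ} (hi : i < k) {p q v : V} (hpq : p ≠ q)
    (hp : p ∈ F i) (hq : q ∈ F i) (hp' : p ∈ F (i + 1)) (hq' : q ∈ F (i + 1)) (hv : v ∈ F (i + 1))
    (hvp : v ≠ p) (hvq : v ≠ q) (hS : Strip G a ((Finset.range (i + 1)).biUnion F) p q) :
    Strip G a ((Finset.range (i + 2)).biUnion F) q v := by
  obtain ⟨s, hs, hsp, hsq, -⟩ := exists_third (h.card i hi.le) hp hq hpq
  obtain ⟨v', -, -, -, hz'⟩ := exists_third (h.card (i + 1) hi) hp' hq' hpq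
  obtain rfl : v = v' := by have := hz' v hv; tauto
  have hopp := h.opposite (D := D) hi hpq hp hq hp' hq' hs hsp hsq hv hvp hvq
  have hside := h.side (D := D) hi hpq hp hq hp' hq' hs hsp hsq
  have heq : (Finset.range (i + 2)).biUnion F = insert v ((Finset.range (i + 1)).biUnion F) := by
    rw [Finset.range_add_one, Finset.biUnion_insert]
    ext z
    simp only [Finset.mem_union, Finset.mem_insert]
    constructor
    · rintro (hz | hz)
      · rcases hz' z hz with rfl | rfl | rfl
        · exact Or.inr (Finset.mem_biUnion.2 ⟨i, by simp, hp⟩)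
        · exact Or.inr (Finset.mem_biUnion.2 ⟨i, by simp, hq⟩)
        · exact Or.inl rfl
      · exact Or.inr hz
    · rintro (rfl | hz)
      · exact Or.inl hv
      · exact Or.inr hz
  rw [heq]
  refine hS.attach ?_ (h.adj _ hi p hp' v hv hvp.symm) (h.adj _ hi q hq' v hv hvq.symm) ?_
  · intro hmem
    obtain ⟨j, hj, hvj⟩ := Finset.mem_biUnion.1 hmem
    have := hside j (by simpa [Nat.lt_succ_iff] using hj) v hvj hvp hvq
    tauto
  · intro z hz hzv
    by_contra! hne
    obtain ⟨j, hj, hzj⟩ := Finset.mem_biUnion.1 hz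
    have h1 := hside j (by simpa [Nat.lt_succ_iff] using hj) z hzj hne.1 hne.2
    have h2 := D.between_iff_of_adj (h.adj i hi.le p hp q hq hpq) hzv hne.1 hne.2 hvp hvq
    tauto

open Classical in
include D in
lemma strip_of_lt (h : TrianglePath G a b F k) {i : ℕ} (hi : i < k) :
    ∀ {u v : V}, u ≠ v → u ∈ F i → v ∈ F i → u ∈ F (i + 1) → v ∈ F (i + 1) →
      Strip G a ((Finset.range (i + 1)).biUnion F) u v := by
  induction i with
  | zero =>
    intro u v huv hu hv hu' hv'
    have ha0 : a ∈ F 0 := (h.mem_left 0 (by omega)).2 rfl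
    have ha1 : a ∉ F 1 := by rw [h.mem_left 1 (by omega)]; omega
    have hau : a ≠ u := by rintro rfl; exact ha1 hu'
    have hav : a ≠ v := by rintro rfl; exact ha1 hv'
    obtain ⟨t, -, -, -, hz⟩ := exists_third (h.card 0 (by omega)) hu hv huv
    obtain rfl : a = t := by have := hz a ha0; tauto
    have heq : (Finset.range (0 + 1)).biUnion F = {a, u, v} := by
      ext z
      simp only [zero_add, Finset.range_one, Finset.singleton_biUnion, Finset.mem_insert,
        Finset.mem_singleton]
      constructor
      · intro h; have := hz z h; tauto
      · rintro (rfl | rfl | rfl) <;> assumption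
    rw [heq]
    exact .triangle (h.adj 0 (by omega) a ha0 u hu hau) (h.adj 0 (by omega) a ha0 v hv hav)
      (h.adj 0 (by omega) u hu v hv huv)
  | succ i ih =>
    intro u v huv hu hv hu' hv'
    obtain ⟨t, ht0, ht, htu, htv, -, hor⟩ := h.turn (D := D) (i := i) (by omega) huv hu hv hu' hv'
    rcases hor with hu0 | hv0
    · exact h.strip_attach (D := D) (by omega) htu ht0 hu0 ht hu hv htv.symm huv.symm
        (ih (by omega) htu ht0 hu0 ht hu)
    · exact (h.strip_attach (D := D) (by omega) htv ht0 hv0 ht hv hu htu.symm huv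
        (ih (by omega) htv ht0 hv0 ht hv)).swap

open Classical in
include D in
lemma isLink (h : TrianglePath G a b F k) : IsLink G ((Finset.range (k + 1)).biUnion F) a b := by
  obtain ⟨i, rfl⟩ : ∃ i, k = i + 1 := ⟨k - 1, by have := h.pos; omega⟩
  obtain ⟨p, q, hpq, hp, hq, hp', hq'⟩ := h.share i (by omega)
  have hb : b ∈ F (i + 1) := (h.mem_right _ le_rfl).2 rfl
  have hb' : b ∉ F i := by rw [h.mem_right _ (by omega)]; omega
  exact Or.inr ⟨q, h.strip_attach (D := D) (by omega) hpq hp hq hp' hq' hb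
    (by rintro rfl; exact hb' hp) (by rintro rfl; exact hb' hq)
    (h.strip_of_lt (D := D) (by omega) hpq hp hq hp' hq')⟩

include D in
/-- An edge shared by successive triangles separates `a` from `b`. -/
lemma separates (h : TrianglePath G a b F k) {i : ℕ} (hi : i < k) {u v : V} (huv : u ≠ v)
    (hu : u ∈ F i) (hv : v ∈ F i) (hu' : u ∈ F (i + 1)) (hv' : v ∈ F (i + 1)) :
    a ≠ u ∧ a ≠ v ∧ b ≠ u ∧ b ≠ v ∧ (Between D.pos u a v ↔ ¬ Between D.pos u b v) := by
  have ha : a ∉ F (i + 1) := by rw [h.mem_left _ (by omega)]; omega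
  have hb : b ∉ F i := by rw [h.mem_right _ (by omega)]; omega
  have hau : a ≠ u := by rintro rfl; exact ha hu'
  have hav : a ≠ v := by rintro rfl; exact ha hv'
  have hbu : b ≠ u := by rintro rfl; exact hb hu
  have hbv : b ≠ v := by rintro rfl; exact hb hv
  refine ⟨hau, hav, hbu, hbv, ?_⟩
  obtain ⟨s, hs, hsu, hsv, -⟩ := exists_third (h.card i hi.le) hu hv huv
  obtain ⟨t, ht, htu, htv, -⟩ := exists_third (h.card _ hi) hu' hv' huv
  have e1 := h.side (D := D) hi huv hu hv hu' hv' hs hsu hsv 0 (by omega) a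
    ((h.mem_left 0 (by omega)).2 rfl) hau hav
  have e2 := h.opposite (D := D) hi huv hu hv hu' hv' hs hsu hsv ht htu htv
  -- The side of `b` comes from the reversed path, in which `F (i + 1)` has index `k - (i + 1)`.
  have e3 := h.reverse.side (D := D) (i := k - (i + 1)) (u := u) (v := v) (t := t) (by omega) huv
  simp only [show k - (k - (i + 1)) = i + 1 by omega,
    show k - (k - (i + 1) + 1) = i by omega] at e3
  have e4 := e3 hu' hv' hu hv ht htu htv 0 (by omega) b
    (by simpa using (h.mem_right k le_rfl).2 rfl) hbu hbv
  rw [e1, e2, e4]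

include D in
/-- Every chain of triangles from `a` to `b` passes through an edge that separates them. -/
lemma exists_shared (h : TrianglePath G a b F k) {u v : V} (huv : G.Adj u v) (hau : a ≠ u)
    (hav : a ≠ v) (hbu : b ≠ u) (hbv : b ≠ v)
    (hsep : Between D.pos u a v ↔ ¬ Between D.pos u b v) :
    ∃ j < k, u ∈ F j ∧ v ∈ F j ∧ u ∈ F (j + 1) ∧ v ∈ F (j + 1) := by
  by_contra! hno
  have same : ∀ j ≤ k, ∀ z ∈ F j, ∀ w ∈ F j, z ≠ u → z ≠ v → w ≠ u → w ≠ v →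
      (Between D.pos u z v ↔ Between D.pos u w v) := by
    intro j hj z hz w hw hzu hzv hwu hwv
    by_cases hzw : z = w
    · rw [hzw]
    · exact D.between_iff_of_adj huv (h.adj j hj z hz w hw hzw) hzu hzv hwu hwv
  have key : ∀ j ≤ k, ∀ z ∈ F j, z ≠ u → z ≠ v →
      (Between D.pos u z v ↔ Between D.pos u a v) := by
    intro j
    induction j with
    | zero =>
      intro hj z hz hzu hzv
      exact same 0 hj z hz a ((h.mem_left 0 hj).2 rfl) hzu hzv hau hav
    | succ j ih =>
      intro hj z hz hzu hzv
      obtain ⟨p, q, hpq, hp, hq, hp', hq'⟩ := h.share j hj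
      -- The shared edge is not `uv`, so it has an end off `u` and `v`, which carries the side over
      -- to the next triangle.
      have : ∃ p, p ∈ F j ∧ p ∈ F (j + 1) ∧ p ≠ u ∧ p ≠ v := by
        by_contra! hcon
        have e1 := hcon p hp hp'
        have e2 := hcon q hq hq'
        have e3 := hno j hj
        by_cases hpu : p = u
        · subst hpu
          have := e2 (Ne.symm hpq)
          subst this
          exact e3 hp hq hp' hq'
        · have := e1 hpu
          subst this
          by_cases hqu : q = u
          · subst hqu
            exact e3 hq hp hq' hp'
          · exact hpq (e2 hqu).symm
      obtain ⟨p, hp, hp', hpu, hpv⟩ := this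
      exact (same (j + 1) hj z hz p hp' hzu hzv hpu hpv).trans (ih (by omega) p hp hpu hpv)
  have := key k le_rfl b ((h.mem_right k le_rfl).2 rfl) hbu hbv
  tauto

-- A shared edge of one path separates `a` from `b`, so the other path also passes through it. Apart
-- from `a` and `b`, every vertex of a path lies on a shared edge. Hence two paths cover the same
-- vertices, and the choice of a shortest path is immaterial.
open Classical in
include D in
lemma subset (h : TrianglePath G a b F k) {F' : ℕ → Finset V} {k' : ℕ}
    (h' : TrianglePath G a b F' k') {j : ℕ} (hj : j ≤ k') :
    F' j ⊆ (Finset.range (k + 1)).biUnion F := by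
  have hedge : ∀ i < k', ∀ u v, u ≠ v → u ∈ F' i → v ∈ F' i → u ∈ F' (i + 1) → v ∈ F' (i + 1) →
      u ∈ (Finset.range (k + 1)).biUnion F ∧ v ∈ (Finset.range (k + 1)).biUnion F := by
    intro i hi u v huv hu hv hu' hv'
    obtain ⟨h1, h2, h3, h4, h5⟩ := h'.separates (D := D) hi huv hu hv hu' hv'
    obtain ⟨j, hj, e1, e2, -⟩ := h.exists_shared (D := D) (h'.adj i hi.le u hu v hv huv)
      h1 h2 h3 h4 h5
    exact ⟨Finset.mem_biUnion.2 ⟨j, by simp; omega, e1⟩,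
      Finset.mem_biUnion.2 ⟨j, by simp; omega, e2⟩⟩
  have ha : a ∈ (Finset.range (k + 1)).biUnion F :=
    Finset.mem_biUnion.2 ⟨0, by simp, (h.mem_left 0 (by omega)).2 rfl⟩
  have hb : b ∈ (Finset.range (k + 1)).biUnion F :=
    Finset.mem_biUnion.2 ⟨k, by simp, (h.mem_right k le_rfl).2 rfl⟩
  intro z hz
  obtain hjk | rfl := Nat.lt_or_eq_of_le hj
  · obtain ⟨u, v, huv, hu, hv, hu', hv'⟩ := h'.share j hjk
    obtain ⟨e1, e2⟩ := hedge j hjk u v huv hu hv hu' hv'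
    rcases j with _ | i
    · obtain ⟨t, -, -, -, hthree⟩ := exists_third (h'.card 0 hj) hu hv huv
      obtain ⟨h1, h2, -⟩ := h'.separates (D := D) hjk huv hu hv hu' hv'
      have e3 := hthree a ((h'.mem_left 0 hj).2 rfl)
      obtain rfl : a = t := by tauto
      rcases hthree z hz with rfl | rfl | rfl <;> assumption
    · obtain ⟨t, ht0, ht, htu, htv, hthree, hor⟩ :=
        h'.turn (D := D) (i := i) hjk huv hu hv hu' hv'
      have e3 : t ∈ (Finset.range (k + 1)).biUnion F := by
        rcases hor with hu0 | hv0
        · exact (hedge i (by omega) t u htu ht0 hu0 ht hu).1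
        · exact (hedge i (by omega) t v htv ht0 hv0 ht hv).1
      rcases hthree z hz with rfl | rfl | rfl <;> assumption
  · obtain ⟨i, rfl⟩ : ∃ i, j = i + 1 := ⟨j - 1, by have := h'.pos; omega⟩
    obtain ⟨u, v, huv, hu, hv, hu', hv'⟩ := h'.share i (by omega)
    obtain ⟨e1, e2⟩ := hedge i (by omega) u v huv hu hv hu' hv'
    obtain ⟨t, -, -, -, hthree⟩ := exists_third (h'.card (i + 1) hj) hu' hv' huv
    obtain ⟨-, -, h1, h2, -⟩ := h'.separates (D := D) (i := i) (by omega) huv hu hv hu' hv'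
    have e3 := hthree b ((h'.mem_right (i + 1) hj).2 rfl)
    obtain rfl : b = t := by tauto
    rcases hthree z hz with rfl | rfl | rfl <;> assumption

end TrianglePath

/-! ### Shortest paths of the weak dual -/

lemma IsShortestBetween.reverse {W : Type*} {H : SimpleGraph W} {S T : Set W} {s t : W}
    {p : H.Walk s t} (hp : IsShortestBetween H S T p) : IsShortestBetween H T S p.reverse := by
  refine ⟨hp.2.1, hp.1, fun s' hs' t' ht' q => ?_⟩
  have := hp.2.2 t' ht' s' hs' q.reverse
  simpa using this

lemma fundamentalVerts_comm {B : Set V} {a b : V} :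
    fundamentalVerts D B a b ⊆ fundamentalVerts D B b a := by
  rintro v (⟨hab, hv⟩ | ⟨hab, s, t, p, hp, F, hF, hv⟩)
  · exact Or.inl ⟨hab.symm, hv.symm⟩
  · exact Or.inr ⟨fun h => hab h.symm, t, s, p.reverse, hp.reverse, F, by simpa using hF, hv⟩

lemma fundamentalVerts_subset {B : Set V} {a b : V} (ha : a ∈ B) (hb : b ∈ B) :
    fundamentalVerts D B a b ⊆ B := by
  rintro v (⟨-, rfl | rfl⟩ | ⟨-, s, t, p, -, F, -, hv⟩)
  · exact ha
  · exact hb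
  · exact F.2.1 hv

/-- All of this is minimality: a later triangle at `a`, an earlier one at `b` or a repetition after
two steps would allow a shorter walk. The length is positive because one triangle containing `a` and
`b` would make them adjacent. -/
lemma trianglePath_of_isShortestBetween (hG : IsNearTriangulation D) {B : Set V} {a b : V}
    (hab : ¬ G.Adj a b) (hne : a ≠ b) {s t : {F : Finset V // IsInnerFace D B F}}
    {p : (weakDual D B).Walk s t}
    (hp : IsShortestBetween (weakDual D B) {F | a ∈ F.1} {F | b ∈ F.1} p) :
    TrianglePath G a b (fun i => (p.getVert i).1) p.length := by
  obtain ⟨hs, ht, hmin⟩ := hp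
  have hcard : ∀ i, (p.getVert i).1.card = 3 := fun i => (p.getVert i).2.card_eq_three hG
  have hadj : ∀ i, ∀ u ∈ (p.getVert i).1, ∀ v ∈ (p.getVert i).1, u ≠ v → G.Adj u v :=
    fun i u hu v hv huv => (p.getVert i).2.adj (hcard i) hu hv huv
  have hleft : ∀ i ≤ p.length, a ∈ (p.getVert i).1 → i = 0 := by
    intro i hi ha
    have := hmin _ ha t ht (p.drop i)
    rw [SimpleGraph.Walk.drop_length] at this
    omega
  have hright : ∀ i ≤ p.length, b ∈ (p.getVert i).1 → i = p.length := by
    intro i hi hb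
    have := hmin s hs _ hb (p.take i)
    rw [SimpleGraph.Walk.take_length] at this
    omega
  have hstep : ∀ i < p.length, (weakDual D B).Adj (p.getVert i) (p.getVert (i + 1)) :=
    fun i hi => p.adj_getVert_succ hi
  refine ⟨?_, fun i _ => hcard i, fun i _ => hadj i, ?_, ?_, ?_, ?_, ?_⟩
  · by_contra h0
    have h0' : p.length = 0 := by omega
    have hst := SimpleGraph.Walk.eq_of_length_eq_zero h0'
    subst hst
    have := hadj 0 a (by simpa using hs) b (by simpa using ht) hne
    exact hab this
  · intro i hi h
    exact (hstep i hi).1 (Subtype.ext h)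
  · intro i hi
    obtain ⟨-, u, v, huv, h1, h2⟩ := hstep i hi
    exact ⟨u, v, huv.ne, h1.1, h1.2, h2.1, h2.2⟩
  · intro i hi h
    have h' : p.getVert i = p.getVert (i + 2) := Subtype.ext h
    have := hmin s hs t ht ((p.take i).append ((p.drop (i + 2)).copy h'.symm rfl))
    rw [SimpleGraph.Walk.length_append, SimpleGraph.Walk.take_length, SimpleGraph.Walk.length_copy,
      SimpleGraph.Walk.drop_length] at this
    omega
  · intro i hi
    refine ⟨hleft i hi, ?_⟩
    rintro rfl
    simpa using hs
  · intro i hi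
    refine ⟨hright i hi, ?_⟩
    rintro rfl
    simpa using ht

/-- The fundamental `a`-`b` subgraph is an edge or a chain of triangles. -/
lemma exists_isLink (hG : IsNearTriangulation D) {B : Set V} {a b : V} (hne : a ≠ b)
    (h : (fundamentalVerts D B a b).Nonempty) :
    ∃ S : Finset V, (S : Set V) = fundamentalVerts D B a b ∧ IsLink G S a b ∧ a ∈ S ∧ b ∈ S := by
  classical
  by_cases hab : G.Adj a b
  · refine ⟨{a, b}, ?_, Or.inl ⟨hab, by congr⟩, by simp, by simp⟩
    ext v
    simp [fundamentalVerts, hab]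
  · obtain ⟨v, ⟨h, -⟩ | ⟨-, s, t, p, hp, -⟩⟩ := h
    · exact absurd h hab
    have hT := trianglePath_of_isShortestBetween hG hab hne hp
    refine ⟨(Finset.range (p.length + 1)).biUnion fun i => (p.getVert i).1, ?_, ?_, ?_, ?_⟩
    · ext v
      constructor
      · intro hv
        obtain ⟨i, hi, hvi⟩ := Finset.mem_biUnion.1 (Finset.mem_coe.1 hv)
        exact Or.inr ⟨hab, s, t, p, hp, _, p.getVert_mem_support i, hvi⟩
      · rintro (⟨h, -⟩ | ⟨-, s', t', p', hp', F, hF, hv⟩)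
        · exact absurd h hab
        · obtain ⟨i, rfl, hi⟩ := SimpleGraph.Walk.mem_support_iff_exists_getVert.1 hF
          have := hT.subset (D := D) (trianglePath_of_isShortestBetween hG hab hne hp') hi hv
          convert Finset.mem_coe.2 this
    · convert hT.isLink (D := D)
    · exact Finset.mem_biUnion.2 ⟨0, by simp, (hT.mem_left 0 (by omega)).2 rfl⟩
    · exact Finset.mem_biUnion.2 ⟨p.length, by simp, (hT.mem_right _ le_rfl).2 rfl⟩

end Faces

/-! ### Walks inside a set of vertices -/

section Blocks

variable {V : Type*} {G : SimpleGraph V}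

/-- `a` and `b` are joined by a walk inside `S`. -/
def Joined (G : SimpleGraph V) (S : Set V) (a b : V) : Prop :=
  ∃ p : G.Walk a b, ∀ z ∈ p.support, z ∈ S

lemma Joined.symm {S : Set V} {a b : V} (h : Joined G S a b) : Joined G S b a := by
  obtain ⟨p, hp⟩ := h
  exact ⟨p.reverse, by simpa using hp⟩

lemma Joined.trans {S : Set V} {a b c : V} (h : Joined G S a b) (h' : Joined G S b c) :
    Joined G S a c := by
  obtain ⟨p, hp⟩ := h
  obtain ⟨q, hq⟩ := h'
  refine ⟨p.append q, fun z hz => ?_⟩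
  rcases (SimpleGraph.Walk.mem_support_append_iff p q).1 hz with h | h
  · exact hp z h
  · exact hq z h

lemma Joined.mono {S T : Set V} {a b : V} (h : Joined G S a b) (hST : S ⊆ T) : Joined G T a b := by
  obtain ⟨p, hp⟩ := h
  exact ⟨p, fun z hz => hST (hp z hz)⟩

lemma Joined.of_induce {S : Set V} {a b : S} (p : (G.induce S).Walk a b) {T : Set V}
    (hT : ∀ z ∈ p.support, (z : V) ∈ T) : Joined G T a b := by
  refine ⟨p.map (SimpleGraph.Embedding.induce S).toHom, fun z hz => ?_⟩
  have hmap := SimpleGraph.Walk.support_map (SimpleGraph.Embedding.induce S).toHom p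
  obtain ⟨w, hw, rfl⟩ := List.mem_map.1 ((congrArg (z ∈ ·) hmap).mp hz)
  exact hT w hw

lemma IsBlock.joined {B : Set V} (hB : IsBlock G B) {a b : V} (ha : a ∈ B) (hb : b ∈ B) :
    Joined G B a b := by
  obtain ⟨p⟩ := hB.1.1.preconnected ⟨a, ha⟩ ⟨b, hb⟩
  exact Joined.of_induce p fun z _ => z.2

lemma IsBlock.joined_diff {B : Set V} (hB : IsBlock G B) {a b v : V} (ha : a ∈ B) (hb : b ∈ B)
    (hav : a ≠ v) (hbv : b ≠ v) : Joined G (B \ {v}) a b := by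
  by_cases hv : v ∈ B
  · have h := hB.1.2 ⟨v, hv⟩
    unfold IsCutvertex at h
    push Not at h
    obtain ⟨p, hp⟩ := h ⟨a, ha⟩ ⟨b, hb⟩ (by simpa using hav) (by simpa using hbv)
      (hB.1.1.preconnected _ _)
    exact Joined.of_induce p fun z hz => ⟨z.2, by rintro rfl; exact hp hz⟩
  · rw [Set.sdiff_singleton_eq_self hv]
    exact hB.joined ha hb

lemma joined_walk_left {x y z : V} [DecidableEq V] (p : G.Walk x y) (hz : z ∈ p.support) :
    Joined G {w | w ∈ (p.takeUntil z hz).support} z x :=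
  Joined.symm ⟨p.takeUntil z hz, fun _ h => h⟩

lemma joined_walk_right {x y z : V} [DecidableEq V] (p : G.Walk x y) (hz : z ∈ p.support) :
    Joined G {w | w ∈ (p.dropUntil z hz).support} z y :=
  ⟨p.dropUntil z hz, fun _ h => h⟩

lemma IsBlock.subset_of_biconnected {B W : Set V} (hB : IsBlock G B) (hBW : B ⊆ W)
    (hconn : ∀ a ∈ W, ∀ b ∈ W, Joined G W a b)
    (hcut : ∀ v, ∀ a ∈ W, ∀ b ∈ W, a ≠ v → b ≠ v → Joined G (W \ {v}) a b) : W ⊆ B := by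
  refine hB.2 ⟨?_, ?_⟩ hBW
  · obtain ⟨⟨b, hb⟩⟩ := hB.1.1.nonempty
    have : Nonempty W := ⟨⟨b, hBW hb⟩⟩
    refine ⟨fun a b => ?_⟩
    obtain ⟨p, hp⟩ := hconn a a.2 b b.2
    exact ⟨p.induce W hp⟩
  · rintro ⟨v, hv⟩ ⟨a, b, hav, hbv, -, h⟩
    obtain ⟨p, hp⟩ := hcut v a a.2 b b.2 (fun e => hav (Subtype.ext e))
      (fun e => hbv (Subtype.ext e))
    have h1 := h (p.induce W fun x hx => (hp x hx).1)
    rw [SimpleGraph.Walk.support_induce, List.mem_attachWith] at h1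
    exact (hp v h1).2 rfl

/-- A vertex in two blocks separates them. -/
lemma IsBlock.mem_support {B B' : Set V} (hB : IsBlock G B) (hB' : IsBlock G B') (hne : B ≠ B')
    {c u w : V} (hc : c ∈ B) (hc' : c ∈ B') (hu : u ∈ B) (huc : u ≠ c) (hw : w ∈ B') (hwc : w ≠ c)
    (p : G.Walk u w) : c ∈ p.support := by
  classical
  by_contra hcp
  set q := p.bypass with hq
  have hqp : q.IsPath := p.bypass_isPath
  have hcq : c ∉ q.support := fun h => hcp (p.support_bypass_subset_support h)
  -- Both blocks together with a path avoiding `c` form a connected set without a cutvertex, against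
  -- the maximality of two different blocks.
  set W : Set V := B ∪ B' ∪ {z | z ∈ q.support} with hW
  have hBW : B ⊆ W := fun z hz => Or.inl (Or.inl hz)
  have hBW' : B' ⊆ W := fun z hz => Or.inl (Or.inr hz)
  have hqW : ∀ z ∈ q.support, z ∈ W := fun z hz => Or.inr hz
  have hleft : ∀ z (hz : z ∈ q.support), ∀ x ∈ (q.takeUntil z hz).support, x ∈ q.support :=
    fun z hz x hx => q.support_takeUntil_subset_support hz hx
  have hright : ∀ z (hz : z ∈ q.support), ∀ x ∈ (q.dropUntil z hz).support, x ∈ q.support :=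
    fun z hz x hx => q.support_dropUntil_subset_support hz hx
  have hconn : ∀ a ∈ W, Joined G W a c := by
    rintro a ((ha | ha) | ha)
    · exact (hB.joined ha hc).mono hBW
    · exact (hB'.joined ha hc').mono hBW'
    · exact ((joined_walk_left q ha).mono fun x hx => hqW x (hleft a ha x hx)).trans
        ((hB.joined hu hc).mono hBW)
  have hcut : ∀ v, ∃ e, ∀ a ∈ W, a ≠ v → Joined G (W \ {v}) a e := by
    intro v
    have hBv : B \ {v} ⊆ W \ {v} := Set.sdiff_subset_sdiff_left hBW
    have hBv' : B' \ {v} ⊆ W \ {v} := Set.sdiff_subset_sdiff_left hBW'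
    by_cases hvc : v = c
    · subst hvc
      have hqv : ∀ z ∈ q.support, z ∈ W \ {v} :=
        fun z hz => ⟨hqW z hz, by rintro rfl; exact hcq hz⟩
      have hwu : Joined G (W \ {v}) w u := Joined.symm ⟨q, hqv⟩
      refine ⟨u, ?_⟩
      rintro a ((ha | ha) | ha) hav
      · exact (hB.joined_diff ha hu hav huc).mono hBv
      · exact ((hB'.joined_diff ha hw hav hwc).mono hBv').trans hwu
      · exact (joined_walk_left q ha).mono fun x hx => hqv x (hleft a ha x hx)
    · refine ⟨c, ?_⟩
      rintro a ((ha | ha) | ha) hav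
      · exact (hB.joined_diff ha hc hav (Ne.symm hvc)).mono hBv
      · exact (hB'.joined_diff ha hc' hav (Ne.symm hvc)).mono hBv'
      -- As `q` is a path, `v` can lie on only one side of `a`; the other side leads to `u` or `w`,
      -- and from there to `c` inside a block.
      · by_cases hv : v ∈ (q.takeUntil a ha).support
        · have hv' : v ∉ (q.dropUntil a ha).support := by
            intro hv'
            have hpath : ((q.takeUntil a ha).append (q.dropUntil a ha)).IsPath := by
              rw [SimpleGraph.Walk.take_spec]; exact hqp
            exact hpath.ne_of_mem_support_of_append (Ne.symm hav) hv hv' rfl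
          have hwv : w ≠ v := by
            rintro rfl
            exact hv' (SimpleGraph.Walk.end_mem_support _)
          exact ((joined_walk_right q ha).mono fun x hx => (⟨hqW x (hright a ha x hx), by
            rintro rfl; exact hv' hx⟩ : x ∈ W \ {v})).trans
            ((hB'.joined_diff hw hc' hwv (Ne.symm hvc)).mono hBv')
        · have huv : u ≠ v := by
            rintro rfl
            exact hv (SimpleGraph.Walk.start_mem_support _)
          exact ((joined_walk_left q ha).mono fun x hx => (⟨hqW x (hleft a ha x hx), by
            rintro rfl; exact hv hx⟩ : x ∈ W \ {v})).trans
            ((hB.joined_diff hu hc huv (Ne.symm hvc)).mono hBv)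
  have h1 : ∀ a ∈ W, ∀ b ∈ W, Joined G W a b :=
    fun a ha b hb => (hconn a ha).trans (hconn b hb).symm
  have h2 : ∀ v, ∀ a ∈ W, ∀ b ∈ W, a ≠ v → b ≠ v → Joined G (W \ {v}) a b := by
    intro v a ha b hb hav hbv
    obtain ⟨e, he⟩ := hcut v
    exact (he a ha hav).trans (he b hb hbv).symm
  have e1 := hB.subset_of_biconnected hBW h1 h2
  have e2 := hB'.subset_of_biconnected hBW' h1 h2
  exact hne (Set.Subset.antisymm (hBW.trans e2) (hBW'.trans e1))

lemma IsBlock.eq_of_two_mem {B B' : Set V} (hB : IsBlock G B) (hB' : IsBlock G B') {c d : V}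
    (hcd : c ≠ d) (hc : c ∈ B) (hc' : c ∈ B') (hd : d ∈ B) (hd' : d ∈ B') : B = B' := by
  by_contra hne
  have := hB.mem_support hB' hne hc hc' hd hcd.symm hd' hcd.symm .nil
  simp [hcd] at this

/-! ### Chains of blocks -/

/-- Blocks `B 0, …, B n` such that `x = c 0` lies in the first, `y = c (n + 1)` in the last, and
successive ones share the cutvertices `c 1, …, c n`. -/
structure BlockChain (G : SimpleGraph V) (x y : V) (B : ℕ → Set V) (c : ℕ → V) (n : ℕ) : Prop where
  block : ∀ i ≤ n, IsBlock G (B i)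
  left : ∀ i ≤ n, c i ∈ B i
  right : ∀ i ≤ n, c (i + 1) ∈ B i
  cut : ∀ i, 1 ≤ i → i ≤ n → IsCutvertex G (c i)
  first : c 0 = x
  last : c (n + 1) = y

/-- A chain with the least number of blocks. -/
structure ShortestChain (G : SimpleGraph V) (x y : V) (B : ℕ → Set V) (c : ℕ → V) (n : ℕ) : Prop
    extends BlockChain G x y B c n where
  min : ∀ B' c' n', BlockChain G x y B' c' n' → n ≤ n'
  ends_ne : x ≠ y

/-- `C` replaces the `t - s` blocks `B s, …, B (t - 1)`. In a shortest chain this forces `t ≤ s +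
1`, from which the order properties of the chain follow. -/
lemma BlockChain.shortcut {x y : V} {B : ℕ → Set V} {c : ℕ → V} {n : ℕ}
    (h : BlockChain G x y B c n) {C : Set V} (hC : IsBlock G C) {s t : ℕ} (hst : s < t)
    (ht : t ≤ n + 1) (hs : c s ∈ C) (htC : c t ∈ C) :
    ∃ B' c', BlockChain G x y B' c' (n - (t - s - 1)) := by
  refine ⟨fun i => if i < s then B i else if i = s then C else B (i + (t - s - 1)),
    fun i => if i ≤ s then c i else c (i + (t - s - 1)), ?_, ?_, ?_, ?_, ?_, ?_⟩
  · intro i hi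
    split_ifs with h1 h2
    · exact h.block i (by omega)
    · exact hC
    · exact h.block _ (by omega)
  · intro i hi
    rcases Nat.lt_trichotomy i s with h1 | rfl | h1
    · rw [if_pos h1, if_pos h1.le]
      exact h.left i (by omega)
    · rw [if_neg (lt_irrefl _), if_pos rfl, if_pos le_rfl]
      exact hs
    · rw [if_neg (by omega), if_neg (by omega), if_neg (by omega)]
      exact h.left _ (by omega)
  · intro i hi
    rcases Nat.lt_trichotomy i s with h1 | rfl | h1
    · rw [if_pos h1, if_pos (by omega)]
      exact h.right i (by omega)
    · rw [if_neg (lt_irrefl _), if_pos rfl, if_neg (by omega),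
        show i + 1 + (t - i - 1) = t by omega]
      exact htC
    · rw [if_neg (by omega), if_neg (by omega), if_neg (by omega),
        show i + 1 + (t - s - 1) = i + (t - s - 1) + 1 by omega]
      exact h.right _ (by omega)
  · intro i hi hin
    split_ifs with h1
    · exact h.cut i hi (by omega)
    · exact h.cut _ (by omega) (by omega)
  · simpa using h.first
  · rw [if_neg (by omega), show n - (t - s - 1) + 1 + (t - s - 1) = n + 1 by omega]
    exact h.last

namespace ShortestChain

variable {x y : V} {B : ℕ → Set V} {c : ℕ → V} {n : ℕ}

lemma le_succ (h : ShortestChain G x y B c n) {C : Set V} (hC : IsBlock G C) {s t : ℕ}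
    (ht : t ≤ n + 1) (hs : c s ∈ C) (htC : c t ∈ C) : t ≤ s + 1 := by
  by_contra hlt
  obtain ⟨B', c', h'⟩ := h.shortcut hC (s := s) (t := t) (by omega) ht hs htC
  have := h.min _ _ _ h'
  omega

lemma ne_of_lt (h : ShortestChain G x y B c n) {s t : ℕ} (hst : s < t) (ht : t ≤ n + 1) :
    c s ≠ c t := by
  intro he
  by_cases htn : t ≤ n
  · have := h.le_succ (h.block t htn) (s := s) (t := t + 1) (by omega)
      (he ▸ h.left t htn) (h.right t htn)
    omega
  · obtain rfl : t = n + 1 := by omega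
    rcases s with _ | s
    · exact h.ends_ne (by rw [← h.first, ← h.last, he])
    · have := h.le_succ (h.block s (by omega)) (s := s) (t := n + 1) le_rfl
        (h.left s (by omega)) (he ▸ h.right s (by omega))
      omega

lemma index (h : ShortestChain G x y B c n) {k m : ℕ} (hk : k ≤ n) (hm : m ≤ n + 1)
    (hmem : c m ∈ B k) : m = k ∨ m = k + 1 := by
  have h1 := h.le_succ (h.block k hk) hm (h.left k hk) hmem
  have h2 := h.le_succ (h.block k hk) (s := m) (t := k + 1) (by omega) hmem (h.right k hk)
  omega

lemma block_ne (h : ShortestChain G x y B c n) {i : ℕ} (hi : i + 1 ≤ n) : B i ≠ B (i + 1) := by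
  intro he
  have := h.index (k := i + 1) (m := i) hi (by omega) (he ▸ h.left i (by omega))
  omega

lemma joined_left (h : ShortestChain G x y B c n) {i : ℕ} (hi : i ≤ n) (k : ℕ) :
    ∀ z ∈ B (i - k), k ≤ i → z ≠ c (i + 1) → Joined G {c (i + 1)}ᶜ z (c i) := by
  induction k with
  | zero =>
    intro z hz _ hzc
    exact ((h.block i hi).joined_diff hz (h.left i hi) hzc (h.ne_of_lt (by omega) (by omega))).mono
      fun w hw => hw.2
  | succ k ih =>
    intro z hz hki hzc
    have h1 := h.right (i - (k + 1)) (by omega)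
    have hne : c (i - (k + 1) + 1) ≠ c (i + 1) := h.ne_of_lt (by omega) (by omega)
    have h2 := h.left (i - (k + 1) + 1) (by omega)
    refine (((h.block _ (by omega)).joined_diff hz h1 hzc hne).mono fun w hw => hw.2).trans
      (ih _ ?_ (by omega) hne)
    rwa [show i - (k + 1) + 1 = i - k by omega] at h2 ⊢

lemma joined_right (h : ShortestChain G x y B c n) {i : ℕ} (k : ℕ) (hi : i + k ≤ n) :
    ∀ z ∈ B (i + k), z ≠ c i → Joined G {c i}ᶜ z (c (i + 1)) := by
  induction k with
  | zero =>
    intro z hz hzc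
    exact ((h.block i hi).joined_diff hz (h.right i hi) hzc
      (h.ne_of_lt (by omega) (by omega)).symm).mono fun w hw => hw.2
  | succ k ih =>
    intro z hz hzc
    have hne : c (i + (k + 1)) ≠ c i := (h.ne_of_lt (by omega) (by omega)).symm
    exact (((h.block _ hi).joined_diff hz (h.left _ hi) hzc hne).mono fun w hw => hw.2).trans
      (ih (by omega) _ (h.right (i + k) (by omega)) hne)

/-- The vertex `c i` separates the blocks before it from the blocks after it. -/
lemma mem_support (h : ShortestChain G x y B c n) {i k l : ℕ} (hki : k < i) (hil : i ≤ l)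
    (hl : l ≤ n) {z w : V} (hz : z ∈ B k) (hw : w ∈ B l) (p : G.Walk z w) : c i ∈ p.support := by
  by_contra hp
  have hzc : z ≠ c i := fun e => hp (e ▸ p.start_mem_support)
  have hwc : w ≠ c i := fun e => hp (e ▸ p.end_mem_support)
  -- After the shift, a walk avoiding `c (i + 1)` would join `c i` to `c (i + 2)`, which lie in the
  -- two blocks that `c (i + 1)` separates.
  obtain ⟨i, rfl⟩ : ∃ j, i = j + 1 := ⟨i - 1, by omega⟩
  have h1 := h.joined_left (i := i) (by omega) (i - k) z
    (by rwa [show i - (i - k) = k by omega]) (by omega) hzc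
  have h2 := h.joined_right (i := i + 1) (l - (i + 1)) (by omega) w
    (by rwa [show i + 1 + (l - (i + 1)) = l by omega]) hwc
  obtain ⟨q, hq⟩ := h1.symm.trans (Joined.trans ⟨p, fun v hv e => hp (e ▸ hv)⟩ h2)
  exact hq _ ((h.block i (by omega)).mem_support (h.block (i + 1) (by omega)) (h.block_ne (by omega))
    (h.right i (by omega)) (h.left (i + 1) (by omega)) (h.left i (by omega))
    (h.ne_of_lt (by omega) (by omega)) (h.right (i + 1) (by omega))
    (h.ne_of_lt (by omega) (by omega)).symm q) rfl

lemma mem_support_of_lt (h : ShortestChain G x y B c n) {i k l : ℕ} (hki : k < i) (hil : i < l)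
    (hl : l ≤ n + 1) (p : G.Walk (c k) (c l)) : c i ∈ p.support := by
  obtain ⟨l, rfl⟩ : ∃ j, l = j + 1 := ⟨l - 1, by omega⟩
  exact h.mem_support (k := k) (l := l) hki (by omega) (by omega) (h.left k (by omega))
    (h.right l (by omega)) p

/-- Deleting a vertex that is not one of the `c i` leaves the union of the blocks connected. -/
lemma joined_of_ne (h : ShortestChain G x y B c n) {v : V} (hv : ∀ i ≤ n, 1 ≤ i → c i ≠ v) (k : ℕ)
    (hk : k ≤ n) : ∀ a ∈ B k, a ≠ v → ∀ l ≤ k, ∀ b ∈ B l, b ≠ v → Joined G {v}ᶜ a b := by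
  induction k with
  | zero =>
    intro a ha hav l hl b hb hbv
    obtain rfl : l = 0 := by omega
    exact ((h.block 0 hk).joined_diff ha hb hav hbv).mono fun w hw => hw.2
  | succ k ih =>
    intro a ha hav l hl b hb hbv
    obtain rfl | hl' := Nat.eq_or_lt_of_le hl
    · exact ((h.block _ hk).joined_diff ha hb hav hbv).mono fun w hw => hw.2
    · have hne := hv (k + 1) hk (by omega)
      exact (((h.block _ hk).joined_diff ha (h.left _ hk) hav hne).mono fun w hw => hw.2).trans
        (ih (by omega) _ (h.right k (by omega)) hne l (by omega) b hb hbv)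

/-- The blocks of the chain cover the graph, and deleting any vertex other than the inner `c i`
leaves their union connected. -/
lemma exists_eq_of_isCutvertex (h : ShortestChain G x y B c n) (hcov : ∀ v, ∃ k ≤ n, v ∈ B k)
    {v : V} (hv : IsCutvertex G v) : ∃ i ≤ n, 1 ≤ i ∧ c i = v := by
  by_contra! hne
  obtain ⟨a, b, hav, hbv, -, hsep⟩ := hv
  obtain ⟨k, hk, ha⟩ := hcov a
  obtain ⟨l, hl, hb⟩ := hcov b
  have : Joined G {v}ᶜ a b := by
    rcases Nat.le_total l k with hlk | hlk
    · exact h.joined_of_ne hne k hk a ha hav l hlk b hb hbv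
    · exact (h.joined_of_ne hne l hl b hb hbv k hlk a ha hav).symm
  obtain ⟨p, hp⟩ := this
  exact hp v (hsep p) rfl

/-- Two shortest chains pass through the same cutvertices. -/
lemma exists_eq (h : ShortestChain G x y B c n) {B' : ℕ → Set V} {c' : ℕ → V} {n' : ℕ}
    (h' : ShortestChain G x y B' c' n') {m : ℕ} (hm : m ≤ n' + 1) : ∃ i ≤ n + 1, c i = c' m := by
  by_cases h0 : m = 0
  · exact ⟨0, by omega, by rw [h0, h.first, h'.first]⟩
  by_cases h1 : m = n' + 1
  · exact ⟨n + 1, le_rfl, by rw [h1, h.last, h'.last]⟩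
  -- A vertex that is no `c i` can be avoided on the way from `x` to `y` through the blocks `B i`,
  -- but the second chain says that `c' m` cannot be avoided.
  by_contra! hne
  have hx := hne 0 (by omega)
  have hy := hne (n + 1) le_rfl
  obtain ⟨p, hp⟩ := h.joined_of_ne (v := c' m) (fun i hi _ => hne i (by omega)) n le_rfl
    _ (h.right n le_rfl) hy 0 (by omega) _ (h.left 0 (by omega)) hx
  have e1 : c (n + 1) = c' (n' + 1) := by rw [h.last, h'.last]
  have e2 : c 0 = c' 0 := by rw [h.first, h'.first]
  have := h'.mem_support_of_lt (i := m) (k := 0) (l := n' + 1) (by omega) (by omega) le_rfl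
    (p.reverse.copy e2 e1)
  rw [SimpleGraph.Walk.support_copy, SimpleGraph.Walk.support_reverse, List.mem_reverse] at this
  exact hp _ this rfl

/-- A passage of a shortest chain is a passage of every other one. -/
lemma passage_eq (h : ShortestChain G x y B c n) {B' : ℕ → Set V} {c' : ℕ → V} {n' : ℕ}
    (h' : ShortestChain G x y B' c' n') {k m l : ℕ} (hk : k ≤ n') (hm : m ≤ n' + 1)
    (hl : l ≤ n' + 1) (hmem : c' m ∈ B' k) (hmem' : c' l ∈ B' k) (hne : c' m ≠ c' l) :
    ∃ i ≤ n, B' k = B i ∧ ((c' m = c i ∧ c' l = c (i + 1)) ∨ (c' m = c (i + 1) ∧ c' l = c i)) := by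
  obtain ⟨s, hs, hsm⟩ := h.exists_eq h' hm
  obtain ⟨t, ht, htl⟩ := h.exists_eq h' hl
  rw [← hsm] at hmem hne ⊢
  rw [← htl] at hmem' hne ⊢
  have h1 := h.le_succ (h'.block k hk) ht hmem hmem'
  have h2 := h.le_succ (h'.block k hk) hs hmem' hmem
  have h3 : s ≠ t := by rintro rfl; exact hne rfl
  rcases Nat.lt_or_gt_of_ne h3 with hlt | hlt
  · obtain rfl : t = s + 1 := by omega
    exact ⟨s, by omega, (h'.block k hk).eq_of_two_mem (h.block s (by omega)) hne hmem
      (h.left s (by omega)) hmem' (h.right s (by omega)), Or.inl ⟨rfl, rfl⟩⟩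
  · obtain rfl : s = t + 1 := by omega
    exact ⟨t, by omega, (h'.block k hk).eq_of_two_mem (h.block t (by omega)) hne hmem
      (h.right t (by omega)) hmem' (h.left t (by omega)), Or.inr ⟨rfl, rfl⟩⟩

end ShortestChain

end Blocks

/-! ### Walks of the block-cutvertex graph -/

section Passages

variable {V : Type*} {G : SimpleGraph V}

lemma BlockChain.cons {x y : V} {B : ℕ → Set V} {c : ℕ → V} {n : ℕ} {C : Set V}
    (hC : IsBlock G C) (hx : x ∈ C) {v : V} (hv : IsCutvertex G v) (hvC : v ∈ C)
    (h : BlockChain G v y B c n) :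
    BlockChain G x y (fun i => Nat.casesOn i C B) (fun i => Nat.casesOn i x c) (n + 1) := by
  refine ⟨?_, ?_, ?_, ?_, rfl, h.last⟩
  · rintro (_ | i) hi
    · exact hC
    · exact h.block i (by omega)
  · rintro (_ | i) hi
    · exact hx
    · exact h.left i (by omega)
  · rintro (_ | i) hi
    · change c 0 ∈ C
      rwa [h.first]
    · exact h.right i (by omega)
  · rintro (_ | _ | i) hi hin
    · omega
    · change IsCutvertex G (c 0)
      rwa [h.first]
    · exact h.cut (i + 1) (by omega) (by omega)

/-- A walk alternates between blocks and cutvertices, so the induction removes two edges at a time.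
The exact length `2 * n` turns a shortest walk into a chain with fewest blocks. -/
lemma exists_blockChain {y : V} {C' : {B : Set V // IsBlock G B}} (hy : y ∈ C'.1) (N : ℕ) :
    ∀ (x : V) (C : {B : Set V // IsBlock G B}) (p : (blockCutGraph G).Walk (.inl C) (.inl C')),
      p.length ≤ N → x ∈ C.1 → ∃ B c n, BlockChain G x y B c n ∧ p.length = 2 * n ∧
        (∀ A, Sum.inl A ∈ p.support → ∃ k ≤ n, B k = A.1) ∧
        (∀ v, Sum.inr v ∈ p.support → ∃ m ≤ n, 1 ≤ m ∧ c m = v.1) := by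
  induction N using Nat.strong_induction_on with
  | _ N ih =>
    intro x C p hp hx
    match p, hp with
    | .nil, _ =>
      refine ⟨fun _ => C.1, fun i => if i = 0 then x else y, 0, ?_, rfl, ?_, ?_⟩
      · refine ⟨fun _ _ => C.2, ?_, ?_, ?_, by simp, by simp⟩
        · intro i hi
          obtain rfl : i = 0 := by omega
          simpa using hx
        · intro i hi
          obtain rfl : i = 0 := by omega
          simpa using hy
        · intro i h1 h2
          omega
      · intro A hA
        simp only [SimpleGraph.Walk.support_nil, List.mem_singleton, Sum.inl.injEq] at hA
        exact ⟨0, le_rfl, by rw [hA]⟩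
      · simp
    | .cons (v := .inl D) hadj _, _ =>
      rcases hadj with ⟨_, _, _, h, _⟩ | ⟨_, _, h, _, _⟩ <;> simp at h
    | .cons (v := .inr v) hadj (.cons (v := .inr w) hadj' _), _ =>
      rcases hadj' with ⟨_, _, h, _, _⟩ | ⟨_, _, _, h, _⟩ <;> simp at h
    | .cons (v := .inr v) hadj (.cons (v := .inl D) hadj' q), hp =>
      have hvC : v.1 ∈ C.1 := by
        rcases hadj with ⟨_, _, h, h', hm⟩ | ⟨_, _, h, _, _⟩
        · rw [Sum.inl.injEq] at h
          rw [Sum.inr.injEq] at h'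
          rwa [h, h']
        · simp at h
      have hvD : v.1 ∈ D.1 := by
        rcases hadj' with ⟨_, _, h, _, _⟩ | ⟨_, _, h, h', hm⟩
        · simp at h
        · rw [Sum.inr.injEq] at h
          rw [Sum.inl.injEq] at h'
          rwa [h, h']
      simp only [SimpleGraph.Walk.length_cons] at hp
      obtain ⟨B, c, n, hch, hlen, hB, hc⟩ := ih q.length (by omega) v.1 D q le_rfl hvD
      refine ⟨_, _, n + 1, hch.cons C.2 hx v.2 hvC, ?_, ?_, ?_⟩
      · simp only [SimpleGraph.Walk.length_cons]
        omega
      · intro A hA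
        simp only [SimpleGraph.Walk.support_cons, List.mem_cons, Sum.inl.injEq, reduceCtorEq,
          false_or] at hA
        rcases hA with rfl | hA
        · exact ⟨0, by omega, rfl⟩
        · obtain ⟨k, hk, hkA⟩ := hB A hA
          exact ⟨k + 1, by omega, hkA⟩
      · intro w hw
        simp only [SimpleGraph.Walk.support_cons, List.mem_cons, Sum.inr.injEq, reduceCtorEq,
          false_or] at hw
        rcases hw with rfl | hw
        · exact ⟨1, by omega, le_rfl, hch.first⟩
        · obtain ⟨m, hm, hm1, hmw⟩ := hc w hw
          exact ⟨m + 1, by omega, by omega, hmw⟩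

lemma BlockChain.exists_walk {x y : V} {B : ℕ → Set V} {c : ℕ → V} {n : ℕ}
    (h : BlockChain G x y B c n) (k : ℕ) (hk : k ≤ n) :
    ∃ p : (blockCutGraph G).Walk (.inl ⟨B 0, h.block 0 (by omega)⟩) (.inl ⟨B k, h.block k hk⟩),
      p.length = 2 * k := by
  induction k with
  | zero => exact ⟨.nil, rfl⟩
  | succ k ih =>
    obtain ⟨p, hp⟩ := ih (by omega)
    have hcut := h.cut (k + 1) (by omega) hk
    have h1 : (blockCutGraph G).Adj (.inl ⟨B k, h.block k (by omega)⟩) (.inr ⟨c (k + 1), hcut⟩) :=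
      Or.inl ⟨_, _, rfl, rfl, h.right k (by omega)⟩
    have h2 : (blockCutGraph G).Adj (.inr ⟨c (k + 1), hcut⟩)
        (.inl ⟨B (k + 1), h.block (k + 1) hk⟩) :=
      Or.inr ⟨_, _, rfl, rfl, h.left (k + 1) hk⟩
    refine ⟨(p.concat h1).concat h2, ?_⟩
    rw [SimpleGraph.Walk.length_concat, SimpleGraph.Walk.length_concat, hp]
    ring

lemma IsPassage.exists_shortestChain {x y : V} {A : Set V} {a b : V} (h : IsPassage G x y A a b) :
    ∃ B c n k m l, ShortestChain G x y B c n ∧ k ≤ n ∧ B k = A ∧ m ≤ n + 1 ∧ c m = a ∧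
      l ≤ n + 1 ∧ c l = b ∧ a ∈ A ∧ b ∈ A ∧ a ≠ b := by
  obtain ⟨hA, s, t, p, ⟨⟨C, rfl, hx⟩, ⟨C', rfl, hy⟩, hmin⟩, hmem, hab, ⟨haA, ha⟩, ⟨hbA, hb⟩⟩ := h
  obtain ⟨B, c, n, hch, hlen, hB, hc⟩ := exists_blockChain hy p.length x C p le_rfl hx
  have hmin' : ∀ B' c' n', BlockChain G x y B' c' n' → n ≤ n' := by
    intro B' c' n' h'
    obtain ⟨q, hq⟩ := h'.exists_walk n' le_rfl
    have := hmin _ ⟨_, rfl, by have := h'.left 0 (by omega); rwa [h'.first] at this⟩ _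
      ⟨_, rfl, by have := h'.right n' le_rfl; rwa [h'.last] at this⟩ q
    omega
  have hidx : ∀ z, (z = x ∨ z = y ∨ ∃ c, Sum.inr c ∈ p.support ∧ c.1 = z) →
      ∃ m ≤ n + 1, c m = z := by
    rintro z (rfl | rfl | ⟨v, hv, rfl⟩)
    · exact ⟨0, by omega, hch.first⟩
    · exact ⟨n + 1, le_rfl, hch.last⟩
    · obtain ⟨m, hm, -, hmv⟩ := hc v hv
      exact ⟨m, by omega, hmv⟩
  obtain ⟨k, hk, hkA⟩ := hB _ hmem
  obtain ⟨m, hm, hma⟩ := hidx a ha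
  obtain ⟨l, hl, hlb⟩ := hidx b hb
  -- If `x = y`, one block is a chain, so minimality leaves only `c 0 = c 1 = x` and no room for two
  -- different ends `a`, `b`.
  have hxy : x ≠ y := by
    rintro rfl
    have h0 : n ≤ 0 := hmin' (fun _ => C.1) (fun _ => x) 0
      ⟨fun _ _ => C.2, fun _ _ => hx, fun _ _ => hx, fun i h1 h2 => by omega, rfl, rfl⟩
    have key : ∀ m ≤ n + 1, c m = x := by
      intro m hm
      have : m = 0 ∨ m = n + 1 := by omega
      rcases this with rfl | rfl
      · exact hch.first
      · exact hch.last
    exact hab (by rw [← hma, ← hlb, key m hm, key l hl])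
  exact ⟨B, c, n, k, m, l, ⟨hch, hmin', hxy⟩, hk, hkA, hm, hma, hl, hlb, haA, hbA, hab⟩

lemma IsFundamental.exists_mem {D : OuterplaneDrawing G} {x y : V} (h : IsFundamental D x y)
    (v : V) : ∃ A a b, IsPassage G x y A a b ∧ v ∈ fundamentalVerts D A a b := by
  have hv : v ∈ (fundamentalSubgraph D x y).verts := by
    rw [h]; trivial
  simpa [fundamentalSubgraph, SimpleGraph.Subgraph.verts_iSup] using hv

/-- A fundamental near-triangulation is a sequence of links. -/
lemma IsFundamental.exists_links {D : OuterplaneDrawing G} (hG : IsNearTriangulation D) {x y : V}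
    (h : IsFundamental D x y) :
    ∃ (B : ℕ → Set V) (c : ℕ → V) (n : ℕ) (S : ℕ → Finset V), ShortestChain G x y B c n ∧
      (∀ k ≤ n, (S k : Set V) ⊆ B k ∧ IsLink G (S k) (c k) (c (k + 1)) ∧ c k ∈ S k ∧
        c (k + 1) ∈ S k) ∧ ∀ v, ∃ k ≤ n, v ∈ S k := by
  obtain ⟨A, a, b, hp, -⟩ := h.exists_mem x
  obtain ⟨B, c, n, -, -, -, hch, -⟩ := hp.exists_shortestChain
  have hcov : ∀ v, ∃ k ≤ n, v ∈ fundamentalVerts D (B k) (c k) (c (k + 1)) := by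
    intro v
    obtain ⟨A, a, b, hp, hv⟩ := h.exists_mem v
    obtain ⟨B', c', n', k, m, l, h', hk, rfl, hm, rfl, hl, rfl, ha, hb, hab⟩ :=
      hp.exists_shortestChain
    obtain ⟨i, hi, hBi, ⟨h1, h2⟩ | ⟨h1, h2⟩⟩ := hch.passage_eq h' hk hm hl ha hb hab
    · exact ⟨i, hi, by rwa [hBi, h1, h2] at hv⟩
    · exact ⟨i, hi, fundamentalVerts_comm (by rwa [hBi, h1, h2] at hv)⟩
  have hsub : ∀ k ≤ n, fundamentalVerts D (B k) (c k) (c (k + 1)) ⊆ B k :=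
    fun k hk => fundamentalVerts_subset (hch.left k hk) (hch.right k hk)
  -- A shortest path of the weak dual is not known to exist beforehand. If the ends are not
  -- adjacent, the neighbour of `c k` on a walk inside `B k` is covered by some link; were it the
  -- link of another block, this neighbour would be `c k` or `c (k + 1)`.
  have hne : ∀ k ≤ n, (fundamentalVerts D (B k) (c k) (c (k + 1))).Nonempty := by
    intro k hk
    by_cases hadj : G.Adj (c k) (c (k + 1))
    · exact ⟨c k, Or.inl ⟨hadj, Or.inl rfl⟩⟩
    · obtain ⟨p, hp⟩ := (hch.block k hk).joined (hch.left k hk) (hch.right k hk)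
      have hck : c k ≠ c (k + 1) := hch.ne_of_lt (by omega) (by omega)
      have hnil : ¬ p.Nil := SimpleGraph.Walk.not_nil_of_ne hck
      have hz := p.adj_snd hnil
      have hzB : p.snd ∈ B k := hp _ (p.getVert_mem_support 1)
      obtain ⟨l, hl, hzl⟩ := hcov p.snd
      obtain rfl | hlt | hlt : l = k ∨ l < k ∨ k < l := by omega
      · exact ⟨_, hzl⟩
      · have := hch.mem_support hlt le_rfl hk (hsub l hl hzl) hzB .nil
        simp only [SimpleGraph.Walk.support_nil, List.mem_singleton] at this
        exact absurd this hz.ne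
      · have := hch.mem_support (i := k + 1) (by omega) hlt hl hzB (hsub l hl hzl) .nil
        simp only [SimpleGraph.Walk.support_nil, List.mem_singleton] at this
        exact absurd (this ▸ hz) hadj
  have hS : ∀ k, ∃ S : Finset V, k ≤ n → (S : Set V) = fundamentalVerts D (B k) (c k) (c (k + 1)) ∧
      IsLink G S (c k) (c (k + 1)) ∧ c k ∈ S ∧ c (k + 1) ∈ S := by
    intro k
    by_cases hk : k ≤ n
    · obtain ⟨S, hS⟩ := exists_isLink hG (hch.ne_of_lt (by omega) (by omega)) (hne k hk)
      exact ⟨S, fun _ => hS⟩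
    · exact ⟨∅, fun h => absurd h hk⟩
  choose S hS using hS
  refine ⟨B, c, n, S, hch, ?_, ?_⟩
  · intro k hk
    obtain ⟨h1, h2⟩ := hS k hk
    exact ⟨h1 ▸ hsub k hk, h2⟩
  · intro v
    obtain ⟨k, hk, hv⟩ := hcov v
    exact ⟨k, hk, by rwa [← (hS k hk).1] at hv⟩

end Passages

/-! ### The order of the cutvertices on a path -/

section Order

variable {V : Type*} {G : SimpleGraph V}

lemma filter_eq_singleton {l : List V} (hl : l.Nodup) {P : V → Prop} [DecidablePred P] {v : V}
    (hv : v ∈ l) (hP : P v) (hu : ∀ z ∈ l, P z → z = v) : l.filter (fun z => P z) = [v] := by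
  rw [← List.perm_singleton, List.perm_ext_iff_of_nodup (hl.filter _) (List.nodup_singleton _)]
  intro z
  simp only [List.mem_filter, decide_eq_true_eq, List.mem_singleton]
  exact ⟨fun h => hu z h.1 h.2, fun h => h ▸ ⟨hv, hP⟩⟩

/-- A path from `c i` to the end must meet `c (i + 1)`, and it cannot meet a later `c l` before
that. Cutting there gives the induction; the condition on `l < i` excludes the vertices already
passed. -/
lemma ShortestChain.filter_support {x y : V} {B : ℕ → Set V} {c : ℕ → V} {n : ℕ}
    (h : ShortestChain G x y B c n) {P : V → Prop} [DecidablePred P]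
    (hP : ∀ v, P v ↔ ∃ i ≤ n + 1, c i = v) (d : ℕ) :
    ∀ (i : ℕ) (_ : i + d = n + 1) (q : G.Walk (c i) (c (n + 1))), q.IsPath →
      (∀ l < i, c l ∉ q.support) →
      q.support.filter (fun v => P v) = (List.range' i (d + 1)).map c := by
  classical
  induction d with
  | zero =>
    intro i hi q hq _
    obtain rfl : i = n + 1 := by omega
    obtain rfl := (SimpleGraph.Walk.isPath_iff_nil.1 hq).eq_nil
    have : P (c (n + 1)) := (hP _).2 ⟨n + 1, le_rfl, rfl⟩
    simp [this]
  | succ d ih =>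
    intro i hi q hq hbefore
    have hmem : c (i + 1) ∈ q.support := by
      by_cases hin : i + 1 = n + 1
      · rw [hin]; exact q.end_mem_support
      · exact h.mem_support_of_lt (by omega) (by omega) le_rfl q
    have hne : c i ≠ c (i + 1) := h.ne_of_lt (by omega) (by omega)
    set T := q.takeUntil _ hmem with hT
    set R := q.dropUntil _ hmem with hR
    have hTp : T.IsPath := hq.takeUntil hmem
    have hRp : R.IsPath := hq.dropUntil hmem
    have hspec : T.append R = q := q.take_spec hmem
    have hTsub : ∀ z ∈ T.support, z ∈ q.support :=
      fun z hz => q.support_takeUntil_subset_support hmem hz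
    have hRsub : ∀ z ∈ R.support, z ∈ q.support :=
      fun z hz => q.support_dropUntil_subset_support hmem hz
    have hRfilter := ih (i + 1) (by omega) R hRp (by
      intro l hl hlR
      obtain rfl | hli : l = i ∨ l < i := by omega
      · have hpath : (T.append R).IsPath := hspec ▸ hq
        exact hpath.ne_of_mem_support_of_append hne T.start_mem_support hlR rfl
      · exact hbefore l hli (hRsub _ hlR))
    have hTtail : T.support.tail.filter (fun v => P v) = [c (i + 1)] := by
      have hnodup := hTp.support_nodup
      rw [← SimpleGraph.Walk.cons_tail_support T, List.nodup_cons] at hnodup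
      refine filter_eq_singleton hnodup.2 ?_ ((hP _).2 ⟨i + 1, by omega, rfl⟩) ?_
      · have := T.end_mem_support
        rw [← SimpleGraph.Walk.cons_tail_support T, List.mem_cons] at this
        exact this.resolve_left hne.symm
      · intro z hz hPz
        obtain ⟨l, hl, rfl⟩ := (hP z).1 hPz
        have hzT : c l ∈ T.support := List.mem_of_mem_tail hz
        obtain hlt | rfl | rfl | hgt : l < i ∨ l = i ∨ l = i + 1 ∨ i + 1 < l := by omega
        · exact absurd (hTsub _ hzT) (hbefore l hlt)
        · exact absurd hz hnodup.1
        · rfl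
        · have h1 := h.mem_support_of_lt (i := i + 1) (by omega) hgt hl (T.takeUntil _ hzT)
          exact absurd h1 (SimpleGraph.Walk.endpoint_notMem_support_takeUntil hTp hzT
            (h.ne_of_lt hgt hl))
    have hci : P (c i) := (hP _).2 ⟨i, by omega, rfl⟩
    have hci' : P (c (i + 1)) := (hP _).2 ⟨i + 1, by omega, rfl⟩
    rw [← SimpleGraph.Walk.cons_tail_support R, List.filter_cons_of_pos (by simpa using hci')]
      at hRfilter
    rw [← hspec, SimpleGraph.Walk.support_append, List.filter_append,
      ← SimpleGraph.Walk.cons_tail_support T, List.filter_cons_of_pos (by simpa using hci), hTtail,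
      List.range'_succ, List.map_cons, ← hRfilter]
    rfl

lemma ShortestChain.cutvertexSequence_eq {x y : V} {B : ℕ → Set V} {c : ℕ → V} {n : ℕ}
    (h : ShortestChain G x y B c n) (hcov : ∀ v, ∃ k ≤ n, v ∈ B k) {p : G.Walk x y}
    (hp : p.IsPath) : cutvertexSequence p = (List.range (n + 2)).map c := by
  classical
  have hP : ∀ v, (v = x ∨ v = y ∨ IsCutvertex G v) ↔ ∃ i ≤ n + 1, c i = v := by
    intro v
    constructor
    · rintro (rfl | rfl | hv)
      · exact ⟨0, by omega, h.first⟩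
      · exact ⟨n + 1, le_rfl, h.last⟩
      · obtain ⟨i, hi, -, hiv⟩ := h.exists_eq_of_isCutvertex hcov hv
        exact ⟨i, by omega, hiv⟩
    · rintro ⟨i, hi, rfl⟩
      by_cases h0 : i = 0
      · exact Or.inl (by rw [h0, h.first])
      by_cases h1 : i = n + 1
      · exact Or.inr (Or.inl (by rw [h1, h.last]))
      · exact Or.inr (Or.inr (h.cut i (by omega) (by omega)))
  have := h.filter_support hP (n + 1) 0 (by omega) (p.copy h.first.symm h.last.symm) (by simpa)
    (by simp)
  rw [SimpleGraph.Walk.support_copy] at this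
  rw [List.range_eq_range', ← this, cutvertexSequence]

lemma numChanges_map_range (c : ℕ → V) (n : ℕ) {P : ℕ → Prop} [DecidablePred P]
    (hP : ∀ i, P i ↔ ¬ SameColourClass G (c i) (c (i + 1))) :
    numChanges G ((List.range (n + 1)).map c) = (List.range n).countP (fun i => P i) := by
  classical
  have : ((List.range (n + 1)).map c).zip ((List.range (n + 1)).map c).tail =
      (List.range n).map fun i => (c i, c (i + 1)) := by
    apply List.ext_getElem
    · simp
    · intro i h1 h2
      simp
  rw [numChanges, this, List.countP_map]
  congr 1
  ext i
  simp [hP]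

end Order

/-! ### Putting the links together -/

section Assembly

variable {V : Type*} [Fintype V] {G : SimpleGraph V} {r : V → V → Prop} {x y : V}
  {B : ℕ → Set V} {c : ℕ → V} {n : ℕ} {S : ℕ → Finset V}

-- Every walk from the earlier links to `S k` meets `c k`. Applied to trivial walks this gives the
-- intersection, and applied to single edges it excludes further edges.
open Classical in
lemma ShortestChain.glue (h : ShortestChain G x y B c n)
    (hS : ∀ k ≤ n, (S k : Set V) ⊆ B k ∧ c k ∈ S k ∧ c (k + 1) ∈ S k) {k : ℕ} (hk1 : 1 ≤ k)
    (hk : k ≤ n) {i j s t : ℕ}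
    (h1 : HasMonomialOn G r ((Finset.range k).biUnion S) x (c k) i s)
    (h2 : HasMonomialOn G r (S k) (c k) (c (k + 1)) t j) (hst : s + t ≤ 2) :
    HasMonomialOn G r ((Finset.range (k + 1)).biUnion S) x (c (k + 1)) i j := by
  have hU : ∀ z ∈ (Finset.range k).biUnion S, ∃ l < k, z ∈ B l := by
    intro z hz
    obtain ⟨l, hl, hzl⟩ := Finset.mem_biUnion.1 hz
    rw [Finset.mem_range] at hl
    exact ⟨l, hl, (hS l (by omega)).1 hzl⟩
  have hsep : ∀ z ∈ (Finset.range k).biUnion S, ∀ w ∈ S k, ∀ p : G.Walk z w, c k ∈ p.support := by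
    intro z hz w hw p
    obtain ⟨l, hl, hzl⟩ := hU z hz
    exact h.mem_support hl le_rfl hk hzl ((hS k hk).1 hw) p
  rw [Finset.range_add_one, Finset.biUnion_insert, Finset.union_comm]
  refine h1.glue h2 hst ?_ ?_ ?_ ?_ (hS k hk).2.1 ?_
  · intro hx
    rw [← h.first] at hx
    have := h.index (m := 0) hk (by omega) ((hS k hk).1 hx)
    omega
  · intro hmem
    obtain ⟨l, hl, hlc⟩ := hU _ hmem
    have := h.index (k := l) (m := k + 1) (by omega) (by omega) hlc
    omega
  · intro z hz hz'
    have := hsep z hz z hz' .nil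
    simpa [eq_comm] using this
  · obtain ⟨l, rfl⟩ : ∃ l, k = l + 1 := ⟨k - 1, by omega⟩
    exact Finset.mem_biUnion.2 ⟨l, by simp, (hS l (by omega)).2.2⟩
  · intro z hz w hw hzc hwc hadj
    have := hsep z hz w hw hadj.toWalk
    simp [hzc.symm, hwc.symm] at this

-- Before any change two monomials are carried along: `(1, 1)` is the one wanted, and `(0, 2)`
-- survives the first change, since the next link then needs nothing at `c k`. After one change `(0,
-- 1)` persists through links with ends of equal colour, and after two changes exponent `0` at the
-- right end leaves room for `(1, 0)` or `(2, 0)`. The predicate `P` is left open because it is used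
-- with two meanings.
open Classical in
lemma ShortestChain.hasMonomialOn_biUnion (h : ShortestChain G x y B c n)
    (hS : ∀ k ≤ n, (S k : Set V) ⊆ B k ∧ c k ∈ S k ∧ c (k + 1) ∈ S k) {P : ℕ → Prop} [DecidablePred P]
    (hdiff : ∀ k ≤ n, P k → HasMonomialOn G r (S k) (c k) (c (k + 1)) 0 1 ∧
      HasMonomialOn G r (S k) (c k) (c (k + 1)) 1 0)
    (hsame : ∀ k ≤ n, ¬ P k → HasMonomialOn G r (S k) (c k) (c (k + 1)) 1 1 ∧
      HasMonomialOn G r (S k) (c k) (c (k + 1)) 0 2 ∧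
      HasMonomialOn G r (S k) (c k) (c (k + 1)) 2 0) (k : ℕ) (hk : k ≤ n) :
    ((List.range (k + 1)).countP (fun i => P i) = 0 →
      HasMonomialOn G r ((Finset.range (k + 1)).biUnion S) x (c (k + 1)) 1 1 ∧
      HasMonomialOn G r ((Finset.range (k + 1)).biUnion S) x (c (k + 1)) 0 2) ∧
    ((List.range (k + 1)).countP (fun i => P i) = 1 →
      HasMonomialOn G r ((Finset.range (k + 1)).biUnion S) x (c (k + 1)) 0 1) ∧
    (2 ≤ (List.range (k + 1)).countP (fun i => P i) →
      HasMonomialOn G r ((Finset.range (k + 1)).biUnion S) x (c (k + 1)) 0 0) := by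
  induction k with
  | zero =>
    rw [zero_add, Finset.range_one, Finset.singleton_biUnion, ← h.first]
    by_cases hP : P 0
    · simpa [List.range_one, hP] using (hdiff 0 hk hP).1
    · simpa [List.range_one, hP] using ⟨(hsame 0 hk hP).1, (hsame 0 hk hP).2.1⟩
  | succ k ih =>
    obtain ⟨ih0, ih1, ih2⟩ := ih (by omega)
    have hg := fun {i j s t : ℕ} => h.glue (r := r) hS (k := k + 1) (by omega) hk (i := i) (j := j)
      (s := s) (t := t)
    rw [List.range_succ, List.countP_append]
    by_cases hP : P (k + 1)
    · obtain ⟨d1, d2⟩ := hdiff (k + 1) hk hP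
      have h1 : [k + 1].countP (fun i => decide (P i)) = 1 := by simp [hP]
      rw [h1]
      refine ⟨fun h0 => by omega, fun h0 => ?_, fun h0 => ?_⟩
      · exact hg (ih0 (by omega)).2 d1 (by norm_num)
      · by_cases h2 : (List.range (k + 1)).countP (fun i => decide (P i)) = 1
        · exact hg (ih1 h2) d2 (by norm_num)
        · exact hg (ih2 (by omega)) d2 (by norm_num)
    · obtain ⟨s1, s2, s3⟩ := hsame (k + 1) hk hP
      have h1 : [k + 1].countP (fun i => decide (P i)) = 0 := by simp [hP]
      rw [h1, add_zero]
      refine ⟨fun h0 => ⟨?_, ?_⟩, fun h0 => ?_, fun h0 => ?_⟩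
      · exact hg (ih0 h0).1 s1 (by norm_num)
      · exact hg (ih0 h0).2 s2 (by norm_num)
      · exact hg (ih1 h0) s1 (by norm_num)
      · exact hg (ih2 h0) s3 (by norm_num)

end Assembly

end Outerplanar

/-! ### The three cases of the theorem -/

open Outerplanar in
theorem theorem11 {V : Type*} [Fintype V] (G : SimpleGraph V) (hconn : G.Connected)
    (D : Outerplanar.OuterplaneDrawing G) (hG : Outerplanar.IsNearTriangulation D)
    (hcut : ∃ v, Outerplanar.IsCutvertex G v)
    (x y : V) (hxy : Outerplanar.IsFundamental D x y)
    (p : G.Walk x y) (hp : p.IsPath)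
    (r : V → V → Prop) (hr : Outerplanar.IsOrientation G r) :
    ((∀ u ∈ Outerplanar.cutvertexSequence p, ∀ v ∈ Outerplanar.cutvertexSequence p,
        Outerplanar.SameColourClass G u v) → Outerplanar.HasMonomial G r x y 1 1) ∧
    (Outerplanar.numChanges G (Outerplanar.cutvertexSequence p) = 1 →
      Outerplanar.HasMonomial G r x y 0 1) ∧
    (2 ≤ Outerplanar.numChanges G (Outerplanar.cutvertexSequence p) →
      Outerplanar.HasMonomial G r x y 0 0) := by
  classical
  obtain ⟨B, c, n, S, h, hS, hcov⟩ := hxy.exists_links hG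
  have hS' : ∀ k ≤ n, (S k : Set V) ⊆ B k ∧ c k ∈ S k ∧ c (k + 1) ∈ S k :=
    fun k hk => ⟨(hS k hk).1, (hS k hk).2.2⟩
  have huniv : (Finset.range (n + 1)).biUnion S = Finset.univ := by
    ext v
    obtain ⟨k, hk, hv⟩ := hcov v
    simp only [Finset.mem_biUnion, Finset.mem_range, Finset.mem_univ, iff_true]
    exact ⟨k, by omega, hv⟩
  have hmono : ∀ {i j}, HasMonomialOn G r Finset.univ x (c (n + 1)) i j →
      HasMonomial G r x y i j := by
    intro i j hm
    rw [h.last] at hm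
    unfold HasMonomialOn at hm
    rwa [polyOn_univ] at hm
  have hlink := fun k (hk : k ≤ n) => (hS k hk).2.1.hasMonomialOn hr
  -- Without a colouring, a link could have ends that vacuously both agree and differ. Hence links
  -- are first sorted by the monomials they have; whichever count results, some monomial has all
  -- exponents at most `2`, and this yields a colouring.
  obtain ⟨C⟩ : Nonempty (G.Coloring (Fin 3)) := by
    have hex : ∃ i ≤ 2, ∃ j ≤ 2, HasMonomial G r x y i j := by
      obtain ⟨h0, h1, h2⟩ := h.hasMonomialOn_biUnion (r := r) hS'
        (P := fun k => HasMonomialOn G r (S k) (c k) (c (k + 1)) 0 1 ∧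
          HasMonomialOn G r (S k) (c k) (c (k + 1)) 1 0)
        (fun k _ hP => hP)
        (fun k hk hP => by
          rcases hlink k hk with hl | hl
          · exact absurd hl.2 hP
          · exact hl.2) n le_rfl
      rw [huniv] at h0 h1 h2
      rcases Nat.lt_or_ge 1 (List.countP _ (List.range (n + 1))) with e | e
      · exact ⟨0, by omega, 0, by omega, hmono (h2 e)⟩
      · rcases Nat.le_one_iff_eq_zero_or_eq_one.1 e with e | e
        · exact ⟨1, by omega, 1, by omega, hmono (h0 e).1⟩
        · exact ⟨0, by omega, 1, by omega, hmono (h1 e)⟩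
    obtain ⟨i, hi, j, hj, m, hm, hmx, hmy, hm2⟩ := hex
    refine coloring_of_coeff_ne_zero hr hm fun v => ?_
    by_cases hvx : v = x
    · rw [hvx]; omega
    by_cases hvy : v = y
    · rw [hvy]; omega
    exact hm2 v hvx hvy
  obtain ⟨h0, h1, h2⟩ := h.hasMonomialOn_biUnion (r := r) hS'
    (P := fun k => ¬ SameColourClass G (c k) (c (k + 1)))
    (fun k hk hP => by
      rcases hlink k hk with hl | hl
      · exact hl.2
      · exact absurd hl.1 hP)
    (fun k hk hP => by
      rcases hlink k hk with hl | hl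
      · exact absurd (not_not.1 hP C) (hl.1 C)
      · exact hl.2) n le_rfl
  rw [huniv] at h0 h1 h2
  -- The sequence has `n + 2` entries, so its `n + 1` successive pairs are the ends of the links `0,
  -- …, n`.
  rw [h.cutvertexSequence_eq (fun v => (hcov v).imp fun k hk => ⟨hk.1, (hS k hk.1).1 hk.2⟩) hp,
    numChanges_map_range c (n + 1) (P := fun k => ¬ SameColourClass G (c k) (c (k + 1)))
      fun _ => Iff.rfl]
  refine ⟨fun hall => hmono (h0 ?_).1, fun hN => hmono (h1 hN), fun hN => hmono (h2 hN)⟩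
  rw [List.countP_eq_zero]
  intro i hi
  rw [List.mem_range] at hi
  simp only [decide_not, Bool.not_eq_true', decide_eq_false_iff_not, not_not]
  exact hall _ (List.mem_map.2 ⟨i, by simp; omega, rfl⟩) _
    (List.mem_map.2 ⟨i + 1, by simp; omega, rfl⟩)
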